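/- Let $S$ be a closed connected surface with a flat cone metric $d_S$ all of whose cone angles are larger than $2\pi$: a compact connected length space in which every point outside a finite set $Con$ has a neighbourhood isometric to a Euclidean disc, and every $p\in Con$ has a neighbourhood isometric to a neighbourhood of the apex of a Euclidean cone of total angle $\mathcal L(p)>2\pi$ (in particular, $S$ may be any such surface of genus $g\ge 2$). Let $\tilde S$ be the universal cover of $S$ with the lifted length metric $d_{\tilde S}$. Let $GS$ be the set of all local isometries $\gamma:\mathbb R\to S$, with the metric $$d_{GS}(\gamma_1,\gamma_2)=\inf_{\tilde\gamma_1,\tilde\gamma_2}\int_{-\infty}^{\infty}d_{\tilde S}(\tilde\gamma_1(s),\tilde\gamma_2(s))\,e^{-2|s|}\,ds ,$$ where the infimum is over all lifts $\tilde\gamma_i:\mathbb R\to\tilde S$ of $\gamma_i$, and with the geodesic flow $(g_t\gamma)(s)=\gamma(s+t)$. The unsigned turning angle $|\theta(\gamma,t)|\in[0,\tfrac12\mathcal L(\gamma(t))]$ is the distance, on the circle of directions at $\gamma(t)$ (whose length is the total angle $\mathcal L(\gamma(t))$, equal to $2\pi$ off $Con$), between the directions of the segments $[\gamma(t),\gamma(t-\delta)]$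 and $[\gamma(t),\gamma(t+\delta)]$ for small $\delta>0$. Let $\mathrm{Sing}=\{\gamma\in GS: |\theta(\gamma,t)|=\pi\text{ for all }t\in\mathbb R\}$, and let $B(\mathrm{Sing},\delta)$ be its open $\delta$-neighbourhood for $d_{GS}$. Let $\phi:GS\to\mathbb R$ be Hölder continuous with respect to $d_{GS}$ and locally constant on $B(\mathrm{Sing},\delta)$ for some $\delta>0$. Then $\phi$ has the global Bowen property: there are $\varepsilon>0$ and $K>0$ such that for all $x,y\in GS$ and all $t>0$ with $d_{GS}(g_rx,g_ry)\le\varepsilon$ for all $0\le r\le t$, $$\left|\int_0^t\bigl(\phi(g_rx)-\phi(g_ry)\bigr)\,dr\right|\le K .$$ -/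

import Mathlib

noncomputable section

namespace FlatSurface

open MeasureTheory

/-- Distance, in the Euclidean cone of total angle `L`, between the points with polar coordinates
`(s, α)` and `(t, β)`. The norm on `AddCircle L` is the arc-length distance on the circle of
length `L`; two points whose directions differ by at least `π` are joined through the apex. -/
def coneDist (L s : ℝ) (α : AddCircle L) (t : ℝ) (β : AddCircle L) : ℝ :=
  Real.sqrt (s ^ 2 + t ^ 2 - 2 * s * t * Real.cos (min ‖α - β‖ Real.pi))

/-- Polar coordinates around `p`: an isometry from the ball of some radius `radius > 0` about the
apex of the Euclidean cone of total angle `L` onto the ball of that radius about `p`, which sends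
the apex to `p`. -/
structure ConeChart {S : Type*} [MetricSpace S] (p : S) (L : ℝ) where
  angle_pos : 0 < L
  radius : ℝ
  radius_pos : 0 < radius
  /-- the point with polar coordinates `(s, α)`; only the values for `0 ≤ s < radius` matter -/
  polar : ℝ → AddCircle L → S
  polar_zero : ∀ α, polar 0 α = p
  dist_polar : ∀ s ∈ Set.Ico 0 radius, ∀ t ∈ Set.Ico 0 radius, ∀ α β,
    dist (polar s α) (polar t β) = coneDist L s α t β
  surj : ∀ x ∈ Metric.ball p radius, ∃ s ∈ Set.Ico 0 radius, ∃ α, polar s α = x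

/-- The length of a path in a metric space. -/
def pathLength {S : Type*} [MetricSpace S] {x y : S} (c : Path x y) : ENNReal :=
  eVariationOn c Set.univ

/-- A closed connected surface with a flat cone metric: a compact connected length space in which
all points outside a finite set `Con` have a neighbourhood isometric to a Euclidean disc (the cone
of angle `2π`), and in which every point of `Con` has a neighbourhood isometric to a neighbourhood
of the apex of a Euclidean cone of total angle greater than `2π`. -/
class IsFlatConeSurface (S : Type*) [MetricSpace S] : Prop
    extends CompactSpace S, ConnectedSpace S where
  length_metric : ∀ (x y : S) (ε : ℝ), 0 < ε →
    ∃ c : Path x y, pathLength c ≤ ENNReal.ofReal (dist x y + ε)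
  exists_cone_points : ∃ Con : Set S, Con.Finite ∧
    (∀ p ∈ Con, ∃ L : ℝ, 2 * Real.pi < L ∧ Nonempty (ConeChart p L)) ∧
    (∀ p ∉ Con, Nonempty (ConeChart p (2 * Real.pi)))

/-- `γ : ℝ → X` is a local isometry, that is, a bi-infinite (locally minimizing, unit speed)
geodesic. -/
def IsLocalIsometry {X : Type*} [Dist X] (γ : ℝ → X) : Prop :=
  ∀ t : ℝ, ∃ ε > 0, ∀ s ∈ Set.Ioo (t - ε) (t + ε), ∀ s' ∈ Set.Ioo (t - ε) (t + ε),
    dist (γ s) (γ s') = |s - s'|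

/-- The space `GS` of geodesics of `S`. -/
def GS (S : Type*) [MetricSpace S] : Type _ := {γ : ℝ → S // IsLocalIsometry γ}

/-- The geodesic flow: `(g_t γ)(s) = γ (s + t)`. -/
def flow {S : Type*} [MetricSpace S] (t : ℝ) (γ : GS S) : GS S :=
  ⟨fun s => γ.1 (s + t), by
    intro u
    obtain ⟨ε, hε, h⟩ := γ.2 (u + t)
    refine ⟨ε, hε, fun s hs s' hs' => ?_⟩
    rw [h (s + t) ⟨by linarith [hs.1], by linarith [hs.2]⟩
      (s' + t) ⟨by linarith [hs'.1], by linarith [hs'.2]⟩]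
    congr 1
    ring⟩

/-- The universal cover of `S` (based at `x₀`): homotopy classes, relative to the end points, of
paths starting at `x₀`. -/
structure UniversalCover (S : Type*) [MetricSpace S] (x₀ : S) where
  proj : S
  cls : Path.Homotopic.Quotient x₀ proj

/-- The length metric on the universal cover that makes the projection a local isometry: the paths
from `a` to `b` in the cover correspond, with the same lengths, to the paths `c` in `S` from the
projection of `a` to that of `b` such that `a` followed by `c` is homotopic to `b`. -/
instance {S : Type*} [MetricSpace S] (x₀ : S) : Dist (UniversalCover S x₀) where
  dist a b := (⨅ c : {c : Path a.proj b.proj //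
    a.cls.trans (Path.Homotopic.Quotient.mk c) = b.cls}, pathLength c.1).toReal

/-- `γ'` is a lift of `γ` to a geodesic of the universal cover. -/
def IsLift {S : Type*} [MetricSpace S] {x₀ : S} (γ' : ℝ → UniversalCover S x₀) (γ : GS S) : Prop :=
  IsLocalIsometry γ' ∧ ∀ s, (γ' s).proj = γ.1 s

/-- The distance between two geodesics of the universal cover. -/
def distCover {S : Type*} [MetricSpace S] {x₀ : S} (γ₁ γ₂ : ℝ → UniversalCover S x₀) : ℝ :=
  ∫ s : ℝ, dist (γ₁ s) (γ₂ s) * Real.exp (-2 * |s|)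

/-- The distance on `GS`: the infimum of the distances between lifts. It does not depend on the
base point `x₀` of the universal cover. -/
def distGS {S : Type*} [MetricSpace S] (x₀ : S) (γ₁ γ₂ : GS S) : ℝ :=
  sInf {d : ℝ | ∃ γ₁' γ₂' : ℝ → UniversalCover S x₀,
    IsLift γ₁' γ₁ ∧ IsLift γ₂' γ₂ ∧ d = distCover γ₁' γ₂'}

/-- The unsigned turning angle `|θ(γ, t)|` equals `a`: in polar coordinates around `γ t`, the
segment along which `γ` arrives at `γ t` and the one along which it leaves have directions `α` and
`β` at distance `a` on the circle of directions, whose length is the total angle `L` at `γ t`. -/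
def HasTurningAngle {S : Type*} [MetricSpace S] (γ : GS S) (t a : ℝ) : Prop :=
  ∃ (L : ℝ) (P : ConeChart (γ.1 t) L) (α β : AddCircle L), ‖α - β‖ = a ∧
    ∃ δ > 0, δ ≤ P.radius ∧ ∀ u ∈ Set.Ico 0 δ,
      γ.1 (t - u) = P.polar u α ∧ γ.1 (t + u) = P.polar u β

/-- The singular geodesics: those that never turn with an angle other than `π`. -/
def Sing (S : Type*) [MetricSpace S] : Set (GS S) :=
  {γ | ∀ t : ℝ, HasTurningAngle γ t Real.pi}

/-- The open `δ`-neighbourhood `B(Sing, δ)` of `Sing` in `GS`. -/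
def nbhdSing {S : Type*} [MetricSpace S] (x₀ : S) (δ : ℝ) : Set (GS S) :=
  {x | ∃ z ∈ Sing S, distGS x₀ x z < δ}

/-- `φ` is a Hölder potential on `GS`. -/
def IsHolder {S : Type*} [MetricSpace S] (x₀ : S) (φ : GS S → ℝ) : Prop :=
  ∃ C α : ℝ, 0 < α ∧ ∀ x y, |φ x - φ y| ≤ C * distGS x₀ x y ^ α

/-- `φ` is locally constant on the set `B` of geodesics. -/
def IsLocallyConstantOn {S : Type*} [MetricSpace S] (x₀ : S) (φ : GS S → ℝ) (B : Set (GS S)) :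
    Prop :=
  ∀ x ∈ B, ∃ η > 0, ∀ y ∈ B, distGS x₀ x y < η → φ y = φ x

/-- The global Bowen property. The first clause says that the integrals in the second one are
genuine integrals. -/
def HasGlobalBowenProperty {S : Type*} [MetricSpace S] (x₀ : S) (φ : GS S → ℝ) : Prop :=
  (∀ (x : GS S) (t : ℝ), IntervalIntegrable (fun r => φ (flow r x)) volume 0 t) ∧
  ∃ ε > 0, ∃ K > 0, ∀ (x y : GS S) (t : ℝ), 0 < t →
    (∀ r ∈ Set.Icc 0 t, distGS x₀ (flow r x) (flow r y) ≤ ε) →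
    |∫ r in (0 : ℝ)..t, (φ (flow r x) - φ (flow r y))| ≤ K

end FlatSurface

end

noncomputable section

namespace FlatSurface

open MeasureTheory Set Filter Topology

/-! All cone angles are at least `2π`, so the surface satisfies the Bruhat–Tits (CAT(0)) inequality
at some uniform scale `ρ`: squared distances between short geodesics are midpoint convex, and nearby
geodesics with the same ends coincide (`IsBruhatTitsScale.eq_of_same_ends`).

Suppose `x` turns at a cone point by at least `π + η`. If `y` stays close to `x`, the points of `y`
just before and after are seen from the cone point under an angle still greater than `π`, so the
geodesic joining them runs through the cone point (`IsBruhatTitsScale.exists_pass`). Hence between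
two such turns `x` and `y` coincide up to a small time shift (`IsBruhatTitsScale.eq_between_turns`).
There `d_GS` decays exponentially with the time to the ends of the common piece, so a Hölder `φ`
contributes a bounded integral (`IsHolder.exists_abs_integral_le`), and the shift costs a bounded
amount.

Where `x` makes no such turn during a long time window, compactness places `x` and `y` near a common
singular geodesic, and local constancy gives `φ x = φ y` (`exists_eq_of_not_turnsBy`). Cutting `[0,
t]` near the first and the last turn thus leaves an error independent of `t`.

The infimum over lifts in `d_GS` is compared with distances in `S` by `distGS_le_of_close` and
`exists_dist_le_of_distGS_le`. -/

/-- The cosine of the angle, truncated at `π`, between two directions differing by `θ`. -/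
def coneCos {L : ℝ} (θ : AddCircle L) : ℝ := Real.cos (min ‖θ‖ Real.pi)

/-! ### Trigonometry on the circle of directions. -/

section coneCos

variable {L : ℝ}

lemma coneCos_le_one (θ : AddCircle L) : coneCos θ ≤ 1 := Real.cos_le_one _

lemma neg_one_le_coneCos (θ : AddCircle L) : -1 ≤ coneCos θ := Real.neg_one_le_cos _

lemma coneCos_neg (θ : AddCircle L) : coneCos (-θ) = coneCos θ := by
  simp [coneCos]

lemma coneCos_sub_comm (α β : AddCircle L) : coneCos (α - β) = coneCos (β - α) := by
  rw [← coneCos_neg, neg_sub]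

lemma coneCos_zero : coneCos (0 : AddCircle L) = 1 := by
  simp [coneCos, Real.pi_pos.le]

lemma coneCos_of_pi_le {θ : AddCircle L} (h : Real.pi ≤ ‖θ‖) : coneCos θ = -1 := by
  simp [coneCos, min_eq_right h]

lemma norm_eq_zero_of_coneCos_eq_one {θ : AddCircle L} (h : coneCos θ = 1) : θ = 0 := by
  have h0 : 0 ≤ min ‖θ‖ Real.pi := le_min (norm_nonneg _) Real.pi_pos.le
  have h1 : min ‖θ‖ Real.pi ≤ Real.pi := min_le_right _ _
  have := (Real.cos_eq_one_iff_of_lt_of_lt (by linarith [Real.pi_pos])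
    (by linarith [Real.pi_pos])).1 h
  rcases min_choice ‖θ‖ Real.pi with h2 | h2
  · rw [h2] at this; exact norm_eq_zero.1 this
  · rw [h2] at this; exact absurd this Real.pi_pos.ne'

lemma pi_le_norm_of_coneCos_eq_neg_one {θ : AddCircle L} (h : coneCos θ = -1) :
    Real.pi ≤ ‖θ‖ := by
  by_contra hlt
  push Not at hlt
  rw [coneCos, min_eq_left hlt.le] at h
  have : Real.cos Real.pi < Real.cos ‖θ‖ :=
    Real.cos_lt_cos_of_nonneg_of_le_pi (norm_nonneg _) le_rfl hlt
  rw [Real.cos_pi] at this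
  linarith

/-- By the triangle inequality the truncated angles `A`, `B` from `γ` satisfy `A + B ≥ π`, whence
`cos A ≤ cos (π - B) = -cos B`. -/
lemma coneCos_add_coneCos_nonpos {α β : AddCircle L} (h : Real.pi ≤ ‖α - β‖) (γ : AddCircle L) :
    coneCos (α - γ) + coneCos (β - γ) ≤ 0 := by
  have hA : 0 ≤ ‖α - γ‖ := norm_nonneg _
  have hB : 0 ≤ ‖β - γ‖ := norm_nonneg _
  have htri : ‖α - β‖ ≤ ‖α - γ‖ + ‖β - γ‖ := by
    have : α - β = (α - γ) - (β - γ) := by abel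
    rw [this]; exact norm_sub_le _ _
  have hsum : Real.pi ≤ min ‖α - γ‖ Real.pi + min ‖β - γ‖ Real.pi := by
    rcases min_cases ‖α - γ‖ Real.pi with h1 | h1 <;>
    rcases min_cases ‖β - γ‖ Real.pi with h2 | h2 <;>
    linarith [Real.pi_pos]
  have := Real.cos_le_cos_of_nonneg_of_le_pi (x := Real.pi - min ‖β - γ‖ Real.pi)
    (y := min ‖α - γ‖ Real.pi) (by linarith [min_le_right ‖β - γ‖ Real.pi])
    (min_le_right _ _) (by linarith)
  rw [Real.cos_pi_sub] at this
  simp only [coneCos]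
  linarith

lemma norm_coe_of_abs_le_pi (hL : 2 * Real.pi ≤ L) {ψ : ℝ} (hψ : |ψ| ≤ Real.pi) :
    ‖(ψ : AddCircle L)‖ = |ψ| := by
  have hL0 : 0 < L := by linarith [Real.pi_pos]
  rw [AddCircle.norm_coe_eq_abs_iff L hL0.ne', abs_of_pos hL0]
  linarith

lemma coneCos_coe_of_abs_le_pi (hL : 2 * Real.pi ≤ L) {ψ : ℝ} (hψ : |ψ| ≤ Real.pi) :
    coneCos (ψ : AddCircle L) = Real.cos ψ := by
  rw [coneCos, norm_coe_of_abs_le_pi hL hψ, min_eq_left hψ, Real.cos_abs]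

/-- Compares the cone with its planar development for differences of two angles below `π`, which may
exceed `π`. If the representative nearest to `0` is not `ψ`, its size is at least `L - |ψ| ≥ 2π -
|ψ|`, which has the same cosine bound. -/
lemma coneCos_coe_le (hL : 2 * Real.pi ≤ L) {ψ : ℝ} (hψ : |ψ| ≤ 2 * Real.pi) :
    coneCos (ψ : AddCircle L) ≤ Real.cos ψ := by
  rcases le_or_gt Real.pi ‖(ψ : AddCircle L)‖ with h | h
  · rw [coneCos_of_pi_le h]; exact Real.neg_one_le_cos _
  rw [coneCos, min_eq_left h.le]
  have hL0 : 0 < L := by linarith [Real.pi_pos]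
  rw [AddCircle.norm_eq] at h ⊢
  set n := round (L⁻¹ * ψ)
  by_cases hn : n = 0
  · simp [hn, Real.cos_abs]
  have hn1 : (1 : ℝ) ≤ |(n : ℝ)| := by exact_mod_cast Int.one_le_abs hn
  have h1 : L - |ψ| ≤ |ψ - n * L| := by
    have : |(n : ℝ) * L| ≤ |ψ| + |ψ - n * L| := by
      have := abs_sub ψ (ψ - n * L)
      simpa using this
    rw [abs_mul, abs_of_pos hL0] at this
    nlinarith
  have := Real.cos_le_cos_of_nonneg_of_le_pi (x := 2 * Real.pi - |ψ|) (y := |ψ - n * L|)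
    (by linarith) h.le (by linarith)
  rw [Real.cos_two_pi_sub, Real.cos_abs, Real.cos_abs] at this
  rwa [Real.cos_abs]

lemma exists_coe_eq_abs_eq_norm (θ : AddCircle L) :
    ∃ ψ : ℝ, (ψ : AddCircle L) = θ ∧ |ψ| = ‖θ‖ := by
  obtain ⟨x, rfl⟩ := QuotientAddGroup.mk_surjective θ
  refine ⟨x - round (L⁻¹ * x) * L, ?_, (AddCircle.norm_eq L).symm⟩
  have : ((round (L⁻¹ * x) * L : ℝ) : AddCircle L) = 0 := by
    rw [AddCircle.coe_eq_zero_iff]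
    exact ⟨round (L⁻¹ * x), by simp⟩
  rw [AddCircle.coe_sub, this, sub_zero]

end coneCos

/-! ### The law of cosines and the Bruhat–Tits inequality in a cone. -/

lemma coneDist_sq (L : ℝ) {s t : ℝ} (hs : 0 ≤ s) (ht : 0 ≤ t) (α β : AddCircle L) :
    coneDist L s α t β ^ 2 = s ^ 2 + t ^ 2 - 2 * s * t * coneCos (α - β) := by
  rw [coneDist, Real.sq_sqrt, coneCos]
  have := coneCos_le_one (α - β)
  rw [coneCos] at this
  nlinarith [mul_nonneg hs ht, sq_nonneg (s - t)]

/-- A midpoint whose direction is at distance at least `π` from one of the end points lies on the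
ray through the other one. -/
lemma cone_midpoint_of_pi_le {L : ℝ} {r s t u : ℝ} (hr : 0 < r) (hs : 0 ≤ s)
    (ht : 0 ≤ t) (hu : 0 ≤ u) {α β γ : AddCircle L} (hπ : Real.pi ≤ ‖α - γ‖)
    (h1 : u ^ 2 = r ^ 2 + s ^ 2 - 2 * r * s * coneCos (α - γ))
    (h2 : u ^ 2 = r ^ 2 + t ^ 2 - 2 * r * t * coneCos (β - γ))
    (h3 : 4 * u ^ 2 = s ^ 2 + t ^ 2 - 2 * s * t * coneCos (α - β)) :
    u = r + s ∧ t = u + r ∧ β = γ := by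
  rw [coneCos_of_pi_le hπ] at h1
  have e1 : u = r + s := by
    have : (u - (r + s)) * (u + (r + s)) = 0 := by nlinarith
    rcases mul_eq_zero.1 this with h | h
    · linarith
    · linarith
  have h4 : 2 * u ≤ s + t := by
    apply abs_le_of_sq_le_sq' _ (by positivity) |>.2
    nlinarith [mul_nonneg hs ht, neg_one_le_coneCos (α - β)]
  have h5 : t - r ≤ u := by
    apply abs_le_of_sq_le_sq' _ (by positivity) |>.2
    nlinarith [mul_nonneg hr.le ht, coneCos_le_one (β - γ)]
  -- With `u = r + s`, `h4` gives `t ≥ u + r` and `h5` the reverse; equality in the triangle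
  -- inequality then forces equal directions.
  have e2 : t = u + r := by linarith
  refine ⟨e1, e2, ?_⟩
  have h6 : 2 * r * t * (1 - coneCos (β - γ)) = 0 := by
    have : u = t - r := by linarith
    rw [this] at h2
    nlinarith
  have ht0 : 0 < t := by linarith
  have h7 : coneCos (β - γ) = 1 := by
    have : 2 * r * t ≠ 0 := by positivity
    have := (mul_eq_zero.1 h6).resolve_left this
    linarith
  exact sub_eq_zero.1 (norm_eq_zero_of_coneCos_eq_one h7)

/-- The angle at the apex between the end points of a segment with a midpoint near both of them
is at most `π`. -/
lemma cone_midpoint_angle_le {L r s t u a b : ℝ} (ha : -Real.pi < a ∧ a < Real.pi)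
    (hb : -Real.pi < b ∧ b < Real.pi) (hr : 0 < r) (hs : 0 ≤ s) (ht : 0 ≤ t) (hu : 0 ≤ u)
    {θ : AddCircle L} (h1 : u ^ 2 = r ^ 2 + s ^ 2 - 2 * r * s * Real.cos a)
    (h2 : u ^ 2 = r ^ 2 + t ^ 2 - 2 * r * t * Real.cos b)
    (h3 : 4 * u ^ 2 = s ^ 2 + t ^ 2 - 2 * s * t * coneCos θ) : |a - b| ≤ Real.pi := by
  -- Projecting the midpoint onto the two rays gives `k1` and `k2`; with `k3` they yield `r (cos a +
  -- cos b) ≥ 0`, whereas the sum of cosines is negative if `|a - b| > π`.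
  by_contra! hd
  have hsa := Real.sin_sq_add_cos_sq a
  have hsb := Real.sin_sq_add_cos_sq b
  have k1 : s - r * Real.cos a ≤ u := by
    apply abs_le_of_sq_le_sq' _ hu |>.2
    have : u ^ 2 - (s - r * Real.cos a) ^ 2 = (r * Real.sin a) ^ 2 := by
      linear_combination h1 - r ^ 2 * hsa
    linarith [sq_nonneg (r * Real.sin a)]
  have k2 : t - r * Real.cos b ≤ u := by
    apply abs_le_of_sq_le_sq' _ hu |>.2
    have : u ^ 2 - (t - r * Real.cos b) ^ 2 = (r * Real.sin b) ^ 2 := by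
      linear_combination h2 - r ^ 2 * hsb
    linarith [sq_nonneg (r * Real.sin b)]
  have k3 : 2 * u ≤ s + t := by
    apply abs_le_of_sq_le_sq' _ (by positivity) |>.2
    have := mul_nonneg (mul_nonneg hs ht)
      (by linarith [neg_one_le_coneCos θ] : 0 ≤ 1 + coneCos θ)
    linarith
  have k4 : Real.cos a + Real.cos b < 0 := by
    rw [Real.cos_add_cos]
    have c1 : 0 < Real.cos ((a + b) / 2) := by
      apply Real.cos_pos_of_mem_Ioo
      rcases lt_abs.1 hd with h | h <;> constructor <;> linarith
    have c2 : Real.cos ((a - b) / 2) < 0 := by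
      rw [← Real.cos_abs, abs_div, abs_two]
      apply Real.cos_neg_of_pi_div_two_lt_of_lt (by linarith)
      have : |a - b| < 2 * Real.pi := abs_lt.2 ⟨by linarith, by linarith⟩
      linarith [Real.pi_pos]
    have := mul_pos c1 (neg_pos.2 c2)
    linarith
  have := mul_pos hr (neg_pos.2 k4)
  linarith

/-- The Bruhat–Tits inequality in a Euclidean cone of total angle at least `2π`, in polar
coordinates: `(r, γ)` is a midpoint of `(s, α)` and `(t, β)`. -/
lemma cone_bruhatTits {L : ℝ} (hL : 2 * Real.pi ≤ L) {r s t u : ℝ} (hr : 0 ≤ r) (hs : 0 ≤ s)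
    (ht : 0 ≤ t) (hu : 0 ≤ u) {α β γ : AddCircle L}
    (h1 : u ^ 2 = r ^ 2 + s ^ 2 - 2 * r * s * coneCos (α - γ))
    (h2 : u ^ 2 = r ^ 2 + t ^ 2 - 2 * r * t * coneCos (β - γ))
    (h3 : 4 * u ^ 2 = s ^ 2 + t ^ 2 - 2 * s * t * coneCos (α - β)) (ζ : AddCircle L) :
    s * coneCos (α - ζ) + t * coneCos (β - ζ) ≤ 2 * r * coneCos (γ - ζ) ∧
      s ^ 2 + t ^ 2 = 2 * r ^ 2 + 2 * u ^ 2 := by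
  have hL0 : 0 < L := by linarith [Real.pi_pos]
  -- The midpoint may be the apex, may lie on a segment through the apex, or may see both ends under
  -- angles less than `π`; only the last case is planar.
  rcases hr.eq_or_lt with rfl | hr
  · have e1 : u = s := by
      have : u ^ 2 = s ^ 2 := by linarith
      exact (pow_left_inj₀ hu hs two_ne_zero).1 this
    have e2 : u = t := by
      have : u ^ 2 = t ^ 2 := by linarith
      exact (pow_left_inj₀ hu ht two_ne_zero).1 this
    subst e1; subst e2
    refine ⟨?_, by ring⟩
    rcases hu.eq_or_lt with rfl | hu
    · simp
    have : coneCos (α - β) = -1 := by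
      have h : 2 * (u ^ 2) * (coneCos (α - β) + 1) = 0 := by nlinarith
      have h' : 2 * u ^ 2 ≠ 0 := by positivity
      linarith [(mul_eq_zero.1 h).resolve_left h']
    have := coneCos_add_coneCos_nonpos (pi_le_norm_of_coneCos_eq_neg_one this) ζ
    nlinarith
  rcases le_or_gt Real.pi ‖α - γ‖ with hα | hα
  · obtain ⟨e1, e2, rfl⟩ := cone_midpoint_of_pi_le hr hs ht hu hα h1 h2 h3
    have := coneCos_add_coneCos_nonpos hα ζ
    have e3 : t = 2 * r + s := by linarith
    refine ⟨?_, by rw [e2, e1]; ring⟩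
    rw [e3]
    nlinarith
  rcases le_or_gt Real.pi ‖β - γ‖ with hβ | hβ
  · rw [coneCos_sub_comm] at h3
    obtain ⟨e1, e2, rfl⟩ := cone_midpoint_of_pi_le hr ht hs hu hβ h2 h1 (by linarith)
    have := coneCos_add_coneCos_nonpos hβ ζ
    have e3 : s = 2 * r + t := by linarith
    refine ⟨?_, by rw [e2, e1]; ring⟩
    rw [e3]
    nlinarith
  -- Develop the sector into the plane with the midpoint in direction `0` and the ends in directions
  -- `a` and `b`.
  obtain ⟨a, ha, ha'⟩ := exists_coe_eq_abs_eq_norm (α - γ)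
  obtain ⟨b, hb, hb'⟩ := exists_coe_eq_abs_eq_norm (β - γ)
  have haπ : |a| < Real.pi := by rw [ha']; exact hα
  have hbπ : |b| < Real.pi := by rw [hb']; exact hβ
  rw [← ha, coneCos_coe_of_abs_le_pi hL haπ.le] at h1
  rw [← hb, coneCos_coe_of_abs_le_pi hL hbπ.le] at h2
  have hab : α - β = ((a - b : ℝ) : AddCircle L) := by
    rw [AddCircle.coe_sub, ha, hb]; abel
  rw [abs_lt] at haπ hbπ
  rcases le_or_gt |a - b| Real.pi with hd | hd
  · rw [hab, coneCos_coe_of_abs_le_pi hL hd, Real.cos_sub] at h3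
    have hsa := Real.sin_sq_add_cos_sq a
    have hsb := Real.sin_sq_add_cos_sq b
    -- In the development the sum of the two end vectors is twice the midpoint vector `(r, 0)`.
    have key : (s * Real.cos a + t * Real.cos b - 2 * r) ^ 2
        + (s * Real.sin a + t * Real.sin b) ^ 2 = 0 := by
      linear_combination (-2) * h1 - 2 * h2 + h3 + s ^ 2 * hsa + t ^ 2 * hsb
    have q1 := sq_nonneg (s * Real.cos a + t * Real.cos b - 2 * r)
    have q2 := sq_nonneg (s * Real.sin a + t * Real.sin b)
    have hX : s * Real.cos a + t * Real.cos b = 2 * r :=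
      sub_eq_zero.1 (pow_eq_zero_iff two_ne_zero |>.1 (le_antisymm (by linarith) q1))
    have hY : s * Real.sin a + t * Real.sin b = 0 :=
      pow_eq_zero_iff two_ne_zero |>.1 (le_antisymm (by linarith) q2)
    refine ⟨?_, by linear_combination (-1) * h1 - h2 + 2 * r * hX⟩
    rcases le_or_gt Real.pi ‖γ - ζ‖ with hζ | hζ
    · have k1 := coneCos_add_coneCos_nonpos hζ α
      have k2 := coneCos_add_coneCos_nonpos hζ β
      rw [coneCos_sub_comm γ α, ← ha, coneCos_coe_of_abs_le_pi hL (abs_lt.2 haπ).le,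
        coneCos_sub_comm ζ α] at k1
      rw [coneCos_sub_comm γ β, ← hb, coneCos_coe_of_abs_le_pi hL (abs_lt.2 hbπ).le,
        coneCos_sub_comm ζ β] at k2
      rw [coneCos_of_pi_le hζ]
      nlinarith
    · obtain ⟨c, hc, hc'⟩ := exists_coe_eq_abs_eq_norm (ζ - γ)
      have hcπ : |c| < Real.pi := by rw [hc', norm_sub_rev]; exact hζ
      have e0 : coneCos (γ - ζ) = Real.cos c := by
        rw [coneCos_sub_comm, ← hc, coneCos_coe_of_abs_le_pi hL hcπ.le]
      rw [abs_lt] at hcπ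
      have e1 : α - ζ = ((a - c : ℝ) : AddCircle L) := by
        rw [AddCircle.coe_sub, ha, hc]; abel
      have e2 : β - ζ = ((b - c : ℝ) : AddCircle L) := by
        rw [AddCircle.coe_sub, hb, hc]; abel
      -- The angle from `ζ` to an end may exceed `π`; the cone cosine is then at most the planar
      -- one, which is the direction needed.
      have k1 := coneCos_coe_le hL (ψ := a - c) (abs_le.2 ⟨by linarith, by linarith⟩)
      have k2 := coneCos_coe_le hL (ψ := b - c) (abs_le.2 ⟨by linarith, by linarith⟩)
      rw [← e1, Real.cos_sub] at k1
      rw [← e2, Real.cos_sub] at k2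
      rw [e0]
      have m1 := mul_le_mul_of_nonneg_left k1 hs
      have m2 := mul_le_mul_of_nonneg_left k2 ht
      have : s * (Real.cos a * Real.cos c + Real.sin a * Real.sin c)
        + t * (Real.cos b * Real.cos c + Real.sin b * Real.sin c) = 2 * r * Real.cos c := by
        linear_combination Real.cos c * hX + Real.sin c * hY
      linarith
  · exact absurd hd (cone_midpoint_angle_le haπ hbπ hr hs ht hu h1 h2 h3).not_gt

/-! ### Cone charts. -/

namespace ConeChart

variable {S : Type*} [MetricSpace S] {p : S} {L : ℝ} (P : ConeChart p L)

lemma zero_mem : (0 : ℝ) ∈ Ico 0 P.radius := ⟨le_rfl, P.radius_pos⟩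

lemma dist_sq_polar {s t : ℝ} (hs : s ∈ Ico 0 P.radius) (ht : t ∈ Ico 0 P.radius)
    (α β : AddCircle L) :
    dist (P.polar s α) (P.polar t β) ^ 2 = s ^ 2 + t ^ 2 - 2 * s * t * coneCos (α - β) := by
  rw [P.dist_polar s hs t ht, coneDist_sq L hs.1 ht.1]

lemma dist_center_polar {s : ℝ} (hs : s ∈ Ico 0 P.radius) (α : AddCircle L) :
    dist p (P.polar s α) = s := by
  have := P.dist_sq_polar P.zero_mem hs α α
  rw [P.polar_zero] at this
  have h : dist p (P.polar s α) ^ 2 = s ^ 2 := by rw [this]; ring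
  exact (pow_left_inj₀ dist_nonneg hs.1 two_ne_zero).1 h

lemma exists_polar {x : S} (hx : x ∈ Metric.ball p P.radius) :
    dist p x ∈ Ico 0 P.radius ∧ ∃ α, P.polar (dist p x) α = x := by
  obtain ⟨s, hs, α, rfl⟩ := P.surj x hx
  rw [P.dist_center_polar hs]
  exact ⟨hs, α, rfl⟩

/-- The Bruhat–Tits inequality in a cone chart of angle at least `2π`. -/
lemma bruhatTits (hL : 2 * Real.pi ≤ L) {x y m z : S} (hx : x ∈ Metric.ball p P.radius)
    (hy : y ∈ Metric.ball p P.radius) (hm : m ∈ Metric.ball p P.radius)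
    (hz : z ∈ Metric.ball p P.radius) {u : ℝ} (hxm : dist x m = u) (hym : dist y m = u)
    (hxy : dist x y = 2 * u) :
    dist z m ^ 2 ≤ (dist z x ^ 2 + dist z y ^ 2) / 2 - u ^ 2 := by
  have hu : 0 ≤ u := hxm ▸ dist_nonneg
  obtain ⟨s, hs, α, rfl⟩ := P.surj x hx
  obtain ⟨t, ht, β, rfl⟩ := P.surj y hy
  obtain ⟨r, hr, γ, rfl⟩ := P.surj m hm
  obtain ⟨v, hv, ζ, rfl⟩ := P.surj z hz
  have e1 := P.dist_sq_polar hs hr α γ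
  have e2 := P.dist_sq_polar ht hr β γ
  have e3 := P.dist_sq_polar hs ht α β
  rw [hxm] at e1
  rw [hym] at e2
  rw [hxy] at e3
  obtain ⟨this, hst⟩ := cone_bruhatTits hL hr.1 hs.1 ht.1 hu (α := α) (β := β) (γ := γ) (by linarith)
    (by linarith) (by linarith) ζ
  rw [P.dist_sq_polar hv hr, P.dist_sq_polar hv hs, P.dist_sq_polar hv ht,
    coneCos_sub_comm ζ γ, coneCos_sub_comm ζ α, coneCos_sub_comm ζ β]
  nlinarith [mul_le_mul_of_nonneg_left this hv.1]

end ConeChart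

/-! ### Local-to-global arguments on intervals. -/

section Real

/-- The maximum principle for locally midpoint convex functions. -/
lemma nonpos_of_locally_midpoint_convex {g : ℝ → ℝ} {a b : ℝ} (hg : ContinuousOn g (Icc a b))
    (hm : ∀ u ∈ Ioo a b, ∃ h₀ > 0, ∀ h ∈ Ioo 0 h₀, a ≤ u - h → u + h ≤ b →
      g u ≤ (g (u - h) + g (u + h)) / 2)
    (ha : g a ≤ 0) (hb : g b ≤ 0) {u : ℝ} (hu : u ∈ Icc a b) : g u ≤ 0 := by
  obtain ⟨x, hx, hmax⟩ := isCompact_Icc.exists_isMaxOn ⟨u, hu⟩ hg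
  by_contra! hpos
  have hM : 0 < g x := hpos.trans_le (hmax hu)
  have hcl : IsCompact (Icc a b ∩ g ⁻¹' {g x}) :=
    isCompact_Icc.of_isClosed_subset
      (hg.preimage_isClosed_of_isClosed isClosed_Icc isClosed_singleton) inter_subset_left
  -- At the leftmost maximum, midpoint convexity makes a point further left maximal as well.
  obtain ⟨y, ⟨hy, hgy⟩, hmin⟩ := hcl.exists_isLeast ⟨x, hx, rfl⟩
  have hgy : g y = g x := hgy
  have hya : a < y := lt_of_le_of_ne hy.1 (by rintro rfl; linarith)
  have hyb : y < b := lt_of_le_of_ne hy.2 (by rintro rfl; linarith)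
  obtain ⟨h₀, hh₀, hc⟩ := hm y ⟨hya, hyb⟩
  set h := min (h₀ / 2) (min (y - a) (b - y)) with hh
  have hpos : 0 < h := lt_min (by linarith) (lt_min (by linarith) (by linarith))
  have h1 : h ≤ h₀ / 2 := min_le_left _ _
  have h2 : h ≤ y - a := (min_le_right _ _).trans (min_le_left _ _)
  have h3 : h ≤ b - y := (min_le_right _ _).trans (min_le_right _ _)
  have h4 := hc h ⟨hpos, by linarith⟩ (by linarith) (by linarith)
  have m1 : y - h ∈ Icc a b := ⟨by linarith, by linarith⟩
  have m2 : y + h ∈ Icc a b := ⟨by linarith, by linarith⟩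
  have h5 : g (y + h) ≤ g x := hmax m2
  have h6 : g (y - h) ≤ g x := hmax m1
  have h7 : g (y - h) = g x := by linarith
  have := hmin ⟨m1, h7⟩
  linarith

/-- Chaining along an interval with small steps. -/
lemma chain_of_small_steps {s t h : ℝ} (hh : 0 < h) {p : ℝ → Prop} (hs : p s)
    (hstep : ∀ u ∈ uIcc s t, ∀ v ∈ uIcc s t, |v - u| ≤ h → p u → p v) : p t := by
  obtain ⟨n, hn⟩ := exists_nat_gt (|t - s| / h)
  have hn0 : 0 < n := by
    have : (0 : ℝ) < n := lt_of_le_of_lt (by positivity) hn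
    exact_mod_cast this
  have hn1 : (0 : ℝ) < n := by exact_mod_cast hn0
  have hmem : ∀ k : ℕ, k ≤ n → s + k / n * (t - s) ∈ uIcc s t := fun k hk => by
    have h1 : (k : ℝ) / n ≤ 1 := by rw [div_le_one hn1]; exact_mod_cast hk
    have h0 : (0 : ℝ) ≤ k / n := by positivity
    rw [mem_uIcc]
    rcases le_total s t with hst | hst
    · left; constructor <;> nlinarith
    · right; constructor <;> nlinarith
  have key : ∀ k : ℕ, k ≤ n → p (s + k / n * (t - s)) := by
    intro k
    induction k with
    | zero => intro _; simpa using hs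
    | succ k ih =>
      intro hk
      refine hstep _ (hmem k (by omega)) _ (hmem (k + 1) hk) ?_ (ih (by omega))
      have : s + ((k + 1 : ℕ) : ℝ) / n * (t - s) - (s + k / n * (t - s)) = (t - s) / n := by
        push_cast; ring
      rw [this, abs_div, abs_of_pos hn1, div_le_iff₀ hn1]
      rw [div_lt_iff₀ hh] at hn
      linarith
  have := key n le_rfl
  rwa [div_self hn1.ne', one_mul, add_sub_cancel] at this

/-- Only the triangle inequality is assumed of `D`, because the universal cover carries a bare
`Dist` instance. -/
lemma le_abs_sub_of_locally_le {D : ℝ → ℝ → ℝ} (htri : ∀ r s t, D r t ≤ D r s + D s t)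
    (hloc : ∀ t, ∃ ε > 0, ∀ s ∈ Ioo (t - ε) (t + ε), ∀ s' ∈ Ioo (t - ε) (t + ε),
      D s s' ≤ |s - s'|) (s t : ℝ) : D s t ≤ |s - t| := by
  choose ε hε hD using hloc
  obtain ⟨δ, hδ, hleb⟩ := lebesgue_number_lemma_of_metric (s := uIcc s t) isCompact_uIcc
    (c := fun u => Ioo (u - ε u) (u + ε u)) (fun _ => isOpen_Ioo)
    (fun u _ => mem_iUnion.2 ⟨u, by constructor <;> linarith [hε u]⟩)
  have hsmall : ∀ u ∈ uIcc s t, ∀ v, |v - u| ≤ δ / 2 → D u v ≤ |u - v| := by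
    intro u hu v hv
    obtain ⟨i, hi⟩ := hleb u hu
    refine hD i u (hi (Metric.mem_ball_self hδ)) v (hi ?_)
    rw [Metric.mem_ball, Real.dist_eq]; linarith
  have hord : ∀ u ∈ uIcc s t, ∀ v ∈ uIcc s t, |u - s| ≤ |v - s| → |s - u| + |u - v| = |s - v| := by
    intro u hu v hv huv
    rw [mem_uIcc] at hu hv
    rcases hu with hu | hu <;> rcases hv with hv | hv
    · rw [abs_of_nonneg (by linarith), abs_of_nonneg (by linarith)] at huv
      rw [abs_of_nonpos (by linarith), abs_of_nonpos (by linarith),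
        abs_of_nonpos (by linarith)]; ring
    · have : s = t := by linarith
      have : u = s := by linarith
      have : v = s := by linarith
      subst_vars; simp
    · have : s = t := by linarith
      have : u = s := by linarith
      have : v = s := by linarith
      subst_vars; simp
    · rw [abs_of_nonpos (by linarith), abs_of_nonpos (by linarith)] at huv
      rw [abs_of_nonneg (by linarith), abs_of_nonneg (by linarith),
        abs_of_nonneg (by linarith)]; ring
  -- The chaining principle also allows steps backwards, so the predicate covers all parameters up
  -- to `k`. The `+ 1` handles `s = t`.
  have := chain_of_small_steps (s := 0) (t := 1) (h := (δ / 2) / (|t - s| + 1)) (by positivity)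
    (p := fun k => D s (s + k * (t - s)) ≤ |s - (s + k * (t - s))| ∧
      ∀ l ∈ Icc 0 k, D s (s + l * (t - s)) ≤ |s - (s + l * (t - s))|) ?_ ?_
  · simpa using this.1
  · have h0 : D s (s + 0 * (t - s)) ≤ |s - (s + 0 * (t - s))| := by
      simpa using hsmall s left_mem_uIcc s (by simp; positivity)
    refine ⟨h0, fun l hl => ?_⟩
    have : l = 0 := le_antisymm hl.2 hl.1
    rwa [this]
  · intro k hk l hl hkl hp
    rw [uIcc_of_le zero_le_one] at hk hl
    have hmem : ∀ k ∈ Icc (0 : ℝ) 1, s + k * (t - s) ∈ uIcc s t := fun k hk => by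
      rw [mem_uIcc]
      rcases le_total s t with hst | hst
      · left; constructor <;> nlinarith [hk.1, hk.2]
      · right; constructor <;> nlinarith [hk.1, hk.2]
    have main : ∀ m ∈ Icc 0 l, D s (s + m * (t - s)) ≤ |s - (s + m * (t - s))| := by
      intro m hm
      rcases le_total m k with hmk | hmk
      · exact hp.2 m ⟨hm.1, hmk⟩
      · have hm1 : m ∈ Icc (0 : ℝ) 1 := ⟨hm.1, hm.2.trans hl.2⟩
        refine (htri s (s + k * (t - s)) _).trans ?_
        have e1 : |s + m * (t - s) - (s + k * (t - s))| ≤ δ / 2 := by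
          have : s + m * (t - s) - (s + k * (t - s)) = (m - k) * (t - s) := by ring
          rw [this, abs_mul]
          rw [le_div_iff₀ (by positivity)] at hkl
          have : |m - k| ≤ |l - k| := by
            rw [abs_of_nonneg (by linarith), abs_of_nonneg (by linarith [hm.2])]
            linarith [hm.2]
          nlinarith [abs_nonneg (t - s), abs_nonneg (l - k), abs_nonneg (m - k)]
        have e2 := hsmall _ (hmem k hk) _ e1
        have e3 := hord _ (hmem k hk) _ (hmem m hm1) (by
          simp only [add_sub_cancel_left, abs_mul]
          rw [abs_of_nonneg hk.1, abs_of_nonneg hm1.1]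
          exact mul_le_mul_of_nonneg_right hmk (abs_nonneg _))
        linarith [hp.1]
    exact ⟨main l ⟨hl.1, le_rfl⟩, main⟩

end Real

/-! ### Uniform scales and local convexity of the surface. -/

/-- A choice of polar coordinates around all points of a surface, of angles at least `2π`, with
finitely many exceptions equal to `2π`. -/
structure ConeAtlas (S : Type*) [MetricSpace S] where
  angle : S → ℝ
  chart : ∀ p, ConeChart p (angle p)
  two_pi_le : ∀ p, 2 * Real.pi ≤ angle p
  finite_cone_points : {p | angle p ≠ 2 * Real.pi}.Finite

lemma nonempty_coneAtlas (S : Type*) [MetricSpace S] [IsFlatConeSurface S] :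
    Nonempty (ConeAtlas S) := by
  obtain ⟨Con, hfin, h1, h2⟩ := IsFlatConeSurface.exists_cone_points (S := S)
  have : ∀ p : S, ∃ L, 2 * Real.pi ≤ L ∧ (p ∉ Con → L = 2 * Real.pi) ∧ Nonempty (ConeChart p L) := by
    intro p
    by_cases hp : p ∈ Con
    · obtain ⟨L, hL, hc⟩ := h1 p hp
      exact ⟨L, hL.le, fun h => absurd hp h, hc⟩
    · exact ⟨_, le_rfl, fun _ => rfl, h2 p hp⟩
  choose L hL hL' hc using this
  refine ⟨⟨L, fun p => (hc p).some, hL, hfin.subset fun p hp => ?_⟩⟩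
  by_contra h
  exact hp (hL' p h)

/-- The Bruhat–Tits inequality holds in the balls of radius `ρ`. -/
def IsBruhatTitsScale (S : Type*) [MetricSpace S] (ρ : ℝ) : Prop :=
  ∀ q x y m z : S, x ∈ Metric.ball q ρ → y ∈ Metric.ball q ρ → m ∈ Metric.ball q ρ →
    z ∈ Metric.ball q ρ → ∀ u : ℝ, dist x m = u → dist y m = u → dist x y = 2 * u →
    dist z m ^ 2 ≤ (dist z x ^ 2 + dist z y ^ 2) / 2 - u ^ 2

section Surface

variable {S : Type*} [MetricSpace S]

/-- A Lebesgue number of the cover by chart balls. The same `ρ` serves for the Bruhat–Tits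
inequality and for homotopies of paths. -/
lemma ConeAtlas.exists_ball_subset [CompactSpace S] (A : ConeAtlas S) :
    ∃ ρ > 0, ∀ q, ∃ p, Metric.ball q ρ ⊆ Metric.ball p (A.chart p).radius := by
  obtain ⟨δ, hδ, h⟩ := lebesgue_number_lemma_of_metric (s := (univ : Set S)) isCompact_univ
    (c := fun p => Metric.ball p (A.chart p).radius) (fun _ => Metric.isOpen_ball)
    (fun p _ => mem_iUnion.2 ⟨p, Metric.mem_ball_self (A.chart p).radius_pos⟩)
  exact ⟨δ, hδ, fun q => h q trivial⟩

lemma ConeAtlas.isBruhatTitsScale (A : ConeAtlas S) {ρ : ℝ}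
    (h : ∀ q, ∃ p, Metric.ball q ρ ⊆ Metric.ball p (A.chart p).radius) :
    IsBruhatTitsScale S ρ := by
  intro q x y m z hx hy hm hz u h1 h2 h3
  obtain ⟨p, hp⟩ := h q
  exact (A.chart p).bruhatTits (A.two_pi_le p) (hp hx) (hp hy) (hp hm) (hp hz) h1 h2 h3

lemma edist_add_edist_le_pathLength {x y : S} (c : Path x y) (t : unitInterval) :
    edist x (c t) + edist (c t) y ≤ pathLength c := by
  have h := eVariationOn.Icc_add_Icc c (s := univ) (a := 0) (b := t) (c := 1) t.2.1 t.2.2 trivial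
  have h1 : edist x (c t) ≤ eVariationOn c (univ ∩ Icc 0 t) := by
    have := eVariationOn.edist_le (E := S) c (s := univ ∩ Icc 0 t) (x := 0) (y := t)
      ⟨trivial, le_rfl, t.2.1⟩ ⟨trivial, t.2.1, le_rfl⟩
    simpa using this
  have h2 : edist (c t) y ≤ eVariationOn c (univ ∩ Icc t 1) := by
    have := eVariationOn.edist_le (E := S) c (s := univ ∩ Icc t 1) (x := t) (y := 1)
      ⟨trivial, le_rfl, t.2.2⟩ ⟨trivial, t.2.2, le_rfl⟩
    simpa using this
  calc _ ≤ _ := add_le_add h1 h2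
    _ = _ := h
    _ ≤ _ := eVariationOn.mono _ (subset_univ _)

lemma dist_add_dist_le_of_pathLength_le {x y : S} {c : Path x y} {l : ℝ}
    (hc : pathLength c ≤ ENNReal.ofReal l) (hl : 0 ≤ l) (t : unitInterval) :
    dist x (c t) + dist (c t) y ≤ l := by
  have := (edist_add_edist_le_pathLength c t).trans hc
  rw [edist_dist, edist_dist, ← ENNReal.ofReal_add dist_nonneg dist_nonneg,
    ENNReal.ofReal_le_ofReal_iff hl] at this
  exact this

/-- Midpoints exist in a compact length space. -/
lemma exists_midpoint [IsFlatConeSurface S] (x y : S) :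
    ∃ m, dist x m = dist x y / 2 ∧ dist m y = dist x y / 2 := by
  -- The zeros of `f` are the midpoints; almost shortest paths make its infimum `0`, and compactness
  -- attains it.
  set f : S → ℝ := fun m => |dist x m - dist x y / 2| + max (dist m y - dist x y / 2) 0
  have hf : Continuous f := by fun_prop
  obtain ⟨m, -, hm⟩ := isCompact_univ.exists_isMinOn ⟨x, trivial⟩ hf.continuousOn
  have hle : f m ≤ 0 := by
    refine le_of_forall_pos_le_add fun ε hε => ?_
    obtain ⟨c, hc⟩ := IsFlatConeSurface.length_metric x y ε hε
    have hcont : Continuous fun t => dist x (c t) := by fun_prop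
    obtain ⟨t, ht⟩ : dist x y / 2 ∈ range fun t => dist x (c t) :=
      mem_range_of_exists_le_of_exists_ge hcont ⟨0, by simp only [Path.source, dist_self]; positivity⟩
        ⟨1, by simp only [Path.target]; linarith [dist_nonneg (x := x) (y := y)]⟩
    have h1 := dist_add_dist_le_of_pathLength_le hc (by positivity) t
    have h2 : f m ≤ f (c t) := hm trivial
    have ht : dist x (c t) = dist x y / 2 := ht
    refine h2.trans ?_
    simp only [f, ht, sub_self, abs_zero, zero_add]
    exact max_le (by linarith) hε.le
  have h1 : 0 ≤ |dist x m - dist x y / 2| := abs_nonneg _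
  have h2 : 0 ≤ max (dist m y - dist x y / 2) 0 := le_max_right _ _
  have h3 : |dist x m - dist x y / 2| = 0 := by linarith
  have h4 : dist m y - dist x y / 2 ≤ 0 := (le_max_left _ _).trans (by linarith)
  have h5 := sub_eq_zero.1 (abs_eq_zero.1 h3)
  exact ⟨m, h5, by linarith [dist_triangle x m y]⟩

/-- Convexity of the squared distance between geodesics at the midpoint. -/
lemma IsBruhatTitsScale.dist_midpoints_sq_le [IsFlatConeSurface S] {ρ : ℝ}
    (hρ : IsBruhatTitsScale S ρ) {q x₀ x₁ m y₀ y₁ n : S} {u v : ℝ}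
    (hx₀ : dist x₀ q < ρ / 3) (hx₁ : dist x₁ q < ρ / 3) (hm : dist m q < ρ / 3)
    (hy₀ : dist y₀ q < ρ / 3) (hy₁ : dist y₁ q < ρ / 3) (hn : dist n q < ρ / 3)
    (h1 : dist x₀ m = u) (h2 : dist x₁ m = u) (h3 : dist x₀ x₁ = 2 * u)
    (k1 : dist y₀ n = v) (k2 : dist y₁ n = v) (k3 : dist y₀ y₁ = 2 * v) :
    dist m n ^ 2 ≤ (dist x₀ y₀ ^ 2 + dist x₁ y₁ ^ 2) / 2 := by
  have hpos : 0 ≤ dist x₀ q := dist_nonneg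
  -- A midpoint of a diagonal of the quadrilateral `x₀ x₁ y₁ y₀`: `i4`–`i6` bound the sum of the
  -- squared diagonals by that of the squared sides, which completes the estimate `i1`–`i3`.
  obtain ⟨w, hw1, hw2⟩ := exists_midpoint x₀ y₁
  have hwq : dist w q < ρ := by
    have := dist_triangle x₀ q y₁
    have h' := dist_triangle w x₀ q
    rw [dist_comm q] at this
    rw [dist_comm w x₀] at h'
    linarith
  have B : ∀ {z}, dist z q < ρ / 3 → z ∈ Metric.ball q ρ := fun h => by
    rw [Metric.mem_ball]; linarith
  have i1 := hρ q x₀ x₁ m n (B hx₀) (B hx₁) (B hm) (B hn) u h1 h2 h3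
  have i2 := hρ q y₀ y₁ n x₀ (B hy₀) (B hy₁) (B hn) (B hx₀) v k1 k2 k3
  have i3 := hρ q y₀ y₁ n x₁ (B hy₀) (B hy₁) (B hn) (B hx₁) v k1 k2 k3
  have i4 := hρ q x₀ y₁ w x₁ (B hx₀) (B hy₁) hwq (B hx₁) (dist x₀ y₁ / 2) hw1
    (by rw [dist_comm, hw2]) (by ring)
  have i5 := hρ q x₀ y₁ w y₀ (B hx₀) (B hy₁) hwq (B hy₀) (dist x₀ y₁ / 2) hw1
    (by rw [dist_comm, hw2]) (by ring)
  have i6 : dist x₁ y₀ ^ 2 ≤ 2 * (dist x₁ w ^ 2 + dist y₀ w ^ 2) := by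
    have := dist_triangle_right x₁ y₀ w
    have h0 : 0 ≤ dist x₁ y₀ := dist_nonneg
    nlinarith [sq_nonneg (dist x₁ w - dist y₀ w)]
  rw [dist_comm n x₀, dist_comm n x₁, dist_comm n m] at i1
  rw [dist_comm x₁ x₀, h3] at i4
  rw [dist_comm y₀ x₀, k3] at i5
  linarith

namespace GS

lemma dist_le (γ : GS S) (s t : ℝ) : dist (γ.1 s) (γ.1 t) ≤ |s - t| :=
  le_abs_sub_of_locally_le (D := fun s t => dist (γ.1 s) (γ.1 t)) (fun _ _ _ => dist_triangle _ _ _)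
    (fun t => (γ.2 t).imp fun _ h => ⟨h.1, fun s hs s' hs' => (h.2 s hs s' hs').le⟩) s t

lemma continuous (γ : GS S) : Continuous γ.1 :=
  (LipschitzWith.of_dist_le_mul (K := 1) fun s t => by
    simpa [Real.dist_eq] using γ.dist_le s t).continuous

end GS

variable {ρ : ℝ}

/-- Local isometries are isometric on short intervals. -/
lemma IsBruhatTitsScale.dist_eq (hρ : IsBruhatTitsScale S ρ) (γ : GS S) {s t : ℝ}
    (hst : |s - t| < ρ) : dist (γ.1 s) (γ.1 t) = |s - t| := by
  wlog hlt : s < t generalizing s t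
  · rcases (not_lt.1 hlt).eq_or_lt with rfl | h
    · simp
    · rw [dist_comm, abs_sub_comm]
      rw [abs_sub_comm] at hst
      exact this hst h
  refine le_antisymm (γ.dist_le s t) ?_
  rw [abs_sub_comm, abs_of_pos (by linarith)] at hst ⊢
  by_contra! hneg
  -- `f` is locally midpoint convex and vanishes near `s`. If `f t < 0`, it would lie below a chord
  -- that is negative immediately after `s`.
  set f : ℝ → ℝ := fun u => dist (γ.1 s) (γ.1 u) ^ 2 - (u - s) ^ 2 with hf
  have hft : f t < 0 := by
    have : dist (γ.1 s) (γ.1 t) ^ 2 < (t - s) ^ 2 := by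
      apply pow_lt_pow_left₀ hneg dist_nonneg two_ne_zero
    simp only [hf]; linarith
  have hγ := γ.continuous
  have hts : 0 < t - s := by linarith
  have key : ∀ u ∈ Icc s t, f u - f t * ((u - s) / (t - s)) ≤ 0 := by
    intro u hu
    refine nonpos_of_locally_midpoint_convex (g := fun u => f u - f t * ((u - s) / (t - s)))
      (a := s) (b := t) (by fun_prop) ?_ (by simp [hf]) (by simp [div_self hts.ne']) hu
    intro u hu
    obtain ⟨ε, hε, h⟩ := γ.2 u
    refine ⟨ε, hε, fun k hk ha hb => ?_⟩
    have m0 : u ∈ Ioo (u - ε) (u + ε) := ⟨by linarith, by linarith⟩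
    have m1 : u - k ∈ Ioo (u - ε) (u + ε) := ⟨by linarith [hk.2], by linarith [hk.1]⟩
    have m2 : u + k ∈ Ioo (u - ε) (u + ε) := ⟨by linarith [hk.1], by linarith [hk.2]⟩
    have B : ∀ v ∈ Icc s t, γ.1 v ∈ Metric.ball (γ.1 s) ρ := fun v hv => by
      rw [Metric.mem_ball]
      refine (γ.dist_le v s).trans_lt ?_
      rw [abs_of_nonneg (by linarith [hv.1])]
      linarith [hv.2]
    have := hρ (γ.1 s) (γ.1 (u - k)) (γ.1 (u + k)) (γ.1 u) (γ.1 s)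
      (B _ ⟨ha, by linarith [hk.1]⟩) (B _ ⟨by linarith [hk.1], hb⟩) (B _ ⟨hu.1.le, hu.2.le⟩)
      (B _ ⟨le_rfl, hlt.le⟩) k
      (by rw [h _ m1 _ m0, sub_sub_cancel_left, abs_neg, abs_of_pos hk.1])
      (by rw [h _ m2 _ m0, add_sub_cancel_left, abs_of_pos hk.1])
      (by rw [h _ m1 _ m2, abs_sub_comm, abs_of_pos (by linarith [hk.1])]; ring)
    simp only [hf]
    have e : (u - s) / (t - s) = ((u - k - s) / (t - s) + (u + k - s) / (t - s)) / 2 := by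
      ring
    rw [e]
    linarith
  obtain ⟨ε, hε, h⟩ := γ.2 s
  set e := min (ε / 2) (t - s)
  have he : 0 < e := lt_min (by linarith) hts
  have he1 : e ≤ ε / 2 := min_le_left _ _
  have he2 : e ≤ t - s := min_le_right _ _
  have h1 := key (s + e) ⟨by linarith, by linarith⟩
  have h2 : f (s + e) = 0 := by
    simp only [hf]
    rw [h s ⟨by linarith, by linarith⟩ (s + e) ⟨by linarith, by linarith⟩]
    simp
  rw [h2, add_sub_cancel_left] at h1
  have : 0 < -f t * (e / (t - s)) := mul_pos (by linarith) (by positivity)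
  linarith

/-- Two nearby geodesics with the same end points coincide. -/
lemma IsBruhatTitsScale.eq_of_same_ends [IsFlatConeSurface S] (hρ : IsBruhatTitsScale S ρ)
    (hρ0 : 0 < ρ) (x y : GS S) {a b c l : ℝ} (hl : 0 < l) (hab : a < b) (ha : x.1 a = y.1 c)
    (hb : x.1 b = y.1 (c + l * (b - a)))
    (hxy : ∀ s ∈ Icc a b, dist (x.1 s) (y.1 (c + l * (s - a))) < ρ / 6) :
    ∀ s ∈ Icc a b, x.1 s = y.1 (s + (c - a)) := by
  have hx := x.continuous
  have hy := y.continuous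
  have key : ∀ s ∈ Icc a b, x.1 s = y.1 (c + l * (s - a)) := by
    intro s hs
    have : dist (x.1 s) (y.1 (c + l * (s - a))) ^ 2 ≤ 0 := by
      refine nonpos_of_locally_midpoint_convex
        (g := fun s => dist (x.1 s) (y.1 (c + l * (s - a))) ^ 2) (a := a) (b := b)
        (by fun_prop) ?_ (by simp [ha]) (by simp [hb]) hs
      intro u hu
      -- Both `h` and `h * l` stay below `ρ / 6`, so all six points lie within `ρ / 3` of `x.1 u`.
      refine ⟨ρ / (6 * (1 + l)), by positivity, fun h hh _ _ => ?_⟩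
      have hh1 : h * (6 * (1 + l)) < ρ := by
        rw [← lt_div_iff₀ (by positivity)]; exact hh.2
      have hh0 := hh.1
      have hlh : 0 < h * l := by positivity
      have e0 : dist (x.1 (u - h)) (x.1 u) = h := by
        rw [hρ.dist_eq x] <;> rw [sub_sub_cancel_left, abs_neg, abs_of_pos hh0]
        linarith
      have e1 : dist (x.1 (u + h)) (x.1 u) = h := by
        rw [hρ.dist_eq x] <;> rw [add_sub_cancel_left, abs_of_pos hh0]
        linarith
      have e2 : dist (x.1 (u - h)) (x.1 (u + h)) = 2 * h := by
        have : |u - h - (u + h)| = 2 * h := by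
          rw [abs_sub_comm, abs_of_pos (by linarith)]; ring
        rw [hρ.dist_eq x] <;> rw [this]
        linarith
      have f0 : dist (y.1 (c + l * (u - h - a))) (y.1 (c + l * (u - a))) = h * l := by
        have : |c + l * (u - h - a) - (c + l * (u - a))| = h * l := by
          rw [abs_sub_comm, abs_of_pos (by linarith)]; ring
        rw [hρ.dist_eq y] <;> rw [this]
        linarith
      have f1 : dist (y.1 (c + l * (u + h - a))) (y.1 (c + l * (u - a))) = h * l := by
        have : |c + l * (u + h - a) - (c + l * (u - a))| = h * l := by
          rw [abs_of_pos (by linarith)]; ring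
        rw [hρ.dist_eq y] <;> rw [this]
        linarith
      have f2 : dist (y.1 (c + l * (u - h - a))) (y.1 (c + l * (u + h - a))) = 2 * (h * l) := by
        have : |c + l * (u - h - a) - (c + l * (u + h - a))| = 2 * (h * l) := by
          rw [abs_sub_comm, abs_of_pos (by linarith)]; ring
        rw [hρ.dist_eq y] <;> rw [this]
        linarith
      have g := hxy u ⟨hu.1.le, hu.2.le⟩
      rw [dist_comm] at g
      refine hρ.dist_midpoints_sq_le (q := x.1 u) ?_ ?_ ?_ ?_ ?_ ?_ e0 e1 e2 f0 f1 f2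
      · rw [e0]; linarith
      · rw [e1]; linarith
      · rw [dist_self]; linarith
      · refine (dist_triangle _ (y.1 (c + l * (u - a))) _).trans_lt ?_
        rw [f0]; linarith
      · refine (dist_triangle _ (y.1 (c + l * (u - a))) _).trans_lt ?_
        rw [f1]; linarith
      · linarith
    have h0 : dist (x.1 s) (y.1 (c + l * (s - a))) = 0 :=
      pow_eq_zero_iff two_ne_zero |>.1 (le_antisymm this (sq_nonneg _))
    exact dist_eq_zero.1 h0
  -- Both curves have unit speed, so the reparametrisation is a translation.
  have hl1 : l = 1 := by
    set h := min (b - a) (ρ / (2 * (1 + l)))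
    have hh0 : 0 < h := lt_min (by linarith) (by positivity)
    have hh1 : h ≤ b - a := min_le_left _ _
    have hh2 : h * (2 * (1 + l)) ≤ ρ := by
      rw [← le_div_iff₀ (by positivity)]; exact min_le_right _ _
    have hlh : 0 < l * h := by positivity
    have e1 : dist (x.1 a) (x.1 (a + h)) = h := by
      have : |a - (a + h)| = h := by rw [sub_add_cancel_left, abs_neg, abs_of_pos hh0]
      rw [hρ.dist_eq x] <;> rw [this]
      linarith
    rw [ha, key (a + h) ⟨by linarith, by linarith⟩] at e1
    have : |c - (c + l * (a + h - a))| = l * h := by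
      rw [add_sub_cancel_left, sub_add_cancel_left, abs_neg, abs_of_pos hlh]
    rw [hρ.dist_eq y (by rw [this]; linarith), this] at e1
    exact mul_right_cancel₀ hh0.ne' (by linarith)
  intro s hs
  have e : c + 1 * (s - a) = s + (c - a) := by ring
  rw [key s hs, hl1, e]

end Surface

/-! ### Rays at a cone point and forced passage through it. -/

variable {S : Type*} [MetricSpace S]

namespace ConeChart

variable {p : S} {L : ℝ} (P : ConeChart p L)

/-- Equality case of the law of cosines; positive radii are required because the apex has no
direction. -/
lemma polar_dir_unique {s t : ℝ} (hs : s ∈ Ioo 0 P.radius) (ht : t ∈ Ioo 0 P.radius)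
    {α β : AddCircle L} (h : dist (P.polar s α) (P.polar t β) = |s - t|) : α = β := by
  have := P.dist_sq_polar ⟨hs.1.le, hs.2⟩ ⟨ht.1.le, ht.2⟩ α β
  rw [h, sq_abs] at this
  have h1 : 2 * s * t * (coneCos (α - β) - 1) = 0 := by linarith
  have h2 : 2 * s * t ≠ 0 := by
    have := hs.1; have := ht.1; positivity
  have h3 := (mul_eq_zero.1 h1).resolve_left h2
  exact sub_eq_zero.1 (norm_eq_zero_of_coneCos_eq_one (by linarith))

/-- A segment starting at the centre of a chart is a ray. -/
lemma exists_ray {c : ℝ → S} {R : ℝ} (hR : 0 < R) (hR' : R < P.radius) (h0 : c 0 = p)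
    (hc : ∀ u ∈ Icc 0 R, ∀ v ∈ Icc 0 R, dist (c u) (c v) = |u - v|) :
    ∃ α, ∀ u ∈ Icc 0 R, c u = P.polar u α := by
  have hd : ∀ u ∈ Icc 0 R, dist p (c u) = u := fun u hu => by
    rw [← h0, hc 0 ⟨le_rfl, hR.le⟩ u hu, zero_sub, abs_neg, abs_of_nonneg hu.1]
  have hball : ∀ u ∈ Icc 0 R, c u ∈ Metric.ball p P.radius := fun u hu => by
    rw [Metric.mem_ball, dist_comm, hd u hu]; exact hu.2.trans_lt hR'
  have hRR : R ∈ Icc 0 R := ⟨hR.le, le_rfl⟩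
  obtain ⟨-, α, hα⟩ := P.exists_polar (hball R hRR)
  rw [hd R hRR] at hα
  refine ⟨α, fun u hu => ?_⟩
  rcases hu.1.eq_or_lt with rfl | hu0
  · rw [P.polar_zero, h0]
  obtain ⟨-, β, hβ⟩ := P.exists_polar (hball u hu)
  rw [hd u hu] at hβ
  have := hc u hu R hRR
  rw [← hα, ← hβ] at this
  rw [← hβ, P.polar_dir_unique ⟨hu0, hu.2.trans_lt hR'⟩ ⟨hR, hR'⟩ this]

/-- Directions of nearby points at distance about `R` from the centre are close. -/
lemma norm_dir_sub_le {R η ε s : ℝ} (hR : R ∈ Ioo 0 P.radius) (hη : 0 < η)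
    (hε : ε ≤ R / 2) (hε' : ε ≤ R * min η Real.pi / (4 * Real.pi)) (hs : s ∈ Ico 0 P.radius)
    {α β : AddCircle L} (h : dist (P.polar R α) (P.polar s β) ≤ ε) : ‖α - β‖ ≤ η / 4 := by
  have hπ := Real.pi_pos
  have h1 := P.dist_sq_polar ⟨hR.1.le, hR.2⟩ hs α β
  have hR0 := hR.1
  have hd : 0 ≤ dist (P.polar R α) (P.polar s β) := dist_nonneg
  have h2 : |R - s| ≤ ε := by
    refine le_trans ?_ h
    have := abs_dist_sub_le (P.polar R α) (P.polar s β) p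
    rwa [dist_comm _ p, dist_comm _ p, P.dist_center_polar ⟨hR.1.le, hR.2⟩,
      P.dist_center_polar hs] at this
  have hsR : R / 2 ≤ s := by linarith [(abs_le.1 h2).2]
  set θ := min ‖α - β‖ Real.pi with hθ
  have hθ0 : 0 ≤ θ := le_min (norm_nonneg _) hπ.le
  have hθπ : θ ≤ Real.pi := min_le_right _ _
  have hcos : coneCos (α - β) = Real.cos θ := rfl
  -- The quadratic bound turns a small chord into a small angle. The minimum with `π` in `hε'` keeps
  -- `θ < π`, so that the truncation is inactive.
  have h3 : Real.cos θ ≤ 1 - 2 / Real.pi ^ 2 * θ ^ 2 :=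
    Real.cos_le_one_sub_mul_cos_sq (by rwa [abs_of_nonneg hθ0])
  have h4 : 2 * R * s * (1 - coneCos (α - β)) ≤ ε ^ 2 := by
    have : dist (P.polar R α) (P.polar s β) ^ 2 ≤ ε ^ 2 := pow_le_pow_left₀ hd h 2
    nlinarith [sq_nonneg (R - s)]
  have h5 : R ^ 2 * (1 - coneCos (α - β)) ≤ ε ^ 2 := by
    have : 0 ≤ 1 - coneCos (α - β) := by linarith [coneCos_le_one (α - β)]
    nlinarith [mul_nonneg hR0.le this]
  have h6 : (R * θ) ^ 2 ≤ (Real.pi * ε) ^ 2 := by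
    rw [hcos] at h5
    have h7 : R ^ 2 * (2 / Real.pi ^ 2 * θ ^ 2) ≤ ε ^ 2 := by
      nlinarith [sq_nonneg R]
    have h8 : R ^ 2 * (2 / Real.pi ^ 2 * θ ^ 2) = 2 * (R * θ) ^ 2 / Real.pi ^ 2 := by ring
    rw [h8, div_le_iff₀ (by positivity)] at h7
    nlinarith [sq_nonneg (R * θ)]
  have h7 : R * θ ≤ Real.pi * ε :=
    abs_le_of_sq_le_sq' h6 (by nlinarith) |>.2
  have h8 : θ ≤ min η Real.pi / 4 := by
    have : Real.pi * ε ≤ R * (min η Real.pi / 4) := by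
      calc Real.pi * ε ≤ Real.pi * (R * min η Real.pi / (4 * Real.pi)) :=
            mul_le_mul_of_nonneg_left hε' hπ.le
        _ = R * (min η Real.pi / 4) := by field_simp
    exact le_of_mul_le_mul_left (h7.trans this) hR0
  have h9 : θ < Real.pi := by linarith [min_le_right η Real.pi]
  have h10 : ‖α - β‖ = θ := by
    rcases min_choice ‖α - β‖ Real.pi with h | h
    · rw [hθ, h]
    · rw [hθ, h] at h9; exact absurd h9 (lt_irrefl _)
  rw [h10]
  linarith [min_le_left η Real.pi]

end ConeChart

/-- The geodesic `γ` passes at time `t` through the centre of the chart `P`, along the rays of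
directions `α` and `β`. -/
def HasRays {p : S} {L : ℝ} (P : ConeChart p L) (γ : GS S) (t R : ℝ) (α β : AddCircle L) : Prop :=
  ∀ u ∈ Icc 0 R, γ.1 (t - u) = P.polar u α ∧ γ.1 (t + u) = P.polar u β

variable {ρ : ℝ}

/-- The points at times `t ± R` are `2R` apart and both at distance `R` from `p`, which forces the
cone cosine to be `-1`. -/
lemma IsBruhatTitsScale.exists_hasRays (hρ : IsBruhatTitsScale S ρ) {p : S} {L : ℝ}
    (P : ConeChart p L) {R : ℝ} (hR : R ∈ Ioo 0 P.radius) (hRρ : 2 * R < ρ) (γ : GS S) {t : ℝ}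
    (ht : γ.1 t = p) : ∃ α β, HasRays P γ t R α β ∧ Real.pi ≤ ‖α - β‖ := by
  have hR0 := hR.1
  obtain ⟨α, hα⟩ := P.exists_ray (c := fun u => γ.1 (t - u)) hR.1 hR.2 (by simpa using ht)
    (fun u hu v hv => by
      have : t - u - (t - v) = v - u := by ring
      rw [hρ.dist_eq γ] <;> rw [this, abs_sub_comm]
      rw [abs_lt]; constructor <;> linarith [hu.1, hu.2, hv.1, hv.2])
  obtain ⟨β, hβ⟩ := P.exists_ray (c := fun u => γ.1 (t + u)) hR.1 hR.2 (by simpa using ht)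
    (fun u hu v hv => by
      have : t + u - (t + v) = u - v := by ring
      rw [hρ.dist_eq γ] <;> rw [this]
      rw [abs_lt]; constructor <;> linarith [hu.1, hu.2, hv.1, hv.2])
  refine ⟨α, β, fun u hu => ⟨hα u hu, hβ u hu⟩, ?_⟩
  have e : |t - R - (t + R)| = 2 * R := by
    rw [abs_sub_comm, abs_of_pos (by linarith)]; ring
  have h1 := hρ.dist_eq γ (s := t - R) (t := t + R) (by rw [e]; exact hRρ)
  have h2 := P.dist_sq_polar ⟨hR.1.le, hR.2⟩ ⟨hR.1.le, hR.2⟩ α β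
  rw [← hα R ⟨hR.1.le, le_rfl⟩, ← hβ R ⟨hR.1.le, le_rfl⟩, h1, e] at h2
  apply pi_le_norm_of_coneCos_eq_neg_one
  have h3 : 2 * R ^ 2 * (coneCos (α - β) + 1) = 0 := by linarith
  have h4 : 2 * R ^ 2 ≠ 0 := by positivity
  linarith [(mul_eq_zero.1 h3).resolve_left h4]

/-- A geodesic close to one that turns at `p` with an angle greater than `π` passes through `p`,
and turns there with almost the same angle. -/
lemma IsBruhatTitsScale.exists_pass (hρ : IsBruhatTitsScale S ρ) {p : S} {L : ℝ}
    (P : ConeChart p L) {R : ℝ} (hR0 : 0 < R) (hR : 4 * R < P.radius) (hRρ : 2 * R < ρ)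
    {x y : GS S} {t : ℝ} {α β : AddCircle L} (hx : HasRays P x t R α β) {η : ℝ} (hη : 0 < η)
    (hαβ : Real.pi + η ≤ ‖α - β‖) {ε : ℝ} (hε : ε ≤ R / 2)
    (hε' : ε ≤ R * min η Real.pi / (4 * Real.pi))
    (h1 : dist (x.1 (t - R)) (y.1 (t - R)) ≤ ε) (h2 : dist (x.1 (t + R)) (y.1 (t + R)) ≤ ε) :
    ∃ τ, |τ - t| ≤ ε ∧ y.1 τ = p ∧ ∃ α' β', HasRays P y τ R α' β' ∧
      Real.pi + η / 2 ≤ ‖α' - β'‖ := by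
  have hR' : R ∈ Ioo 0 P.radius := ⟨hR0, by linarith⟩
  have hRm : R ∈ Icc 0 R := ⟨hR0.le, le_rfl⟩
  obtain ⟨ha, hb⟩ := hx R hRm
  have main : ∀ (y' : S) (α : AddCircle L), dist (P.polar R α) y' ≤ ε →
      |dist p y' - R| ≤ ε ∧ dist p y' ∈ Ioo 0 P.radius ∧ ∃ α', P.polar (dist p y') α' = y' ∧
        ‖α - α'‖ ≤ η / 4 := by
    intro y' α h
    have e1 : |dist p y' - R| ≤ ε := by
      refine le_trans ?_ h
      have := abs_dist_sub_le y' (P.polar R α) p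
      rwa [dist_comm y' p, dist_comm _ p, P.dist_center_polar ⟨hR0.le, hR'.2⟩,
        dist_comm y'] at this
    obtain ⟨e2, e3⟩ := abs_le.1 e1
    have hball : y' ∈ Metric.ball p P.radius := by
      rw [Metric.mem_ball, dist_comm]; linarith
    obtain ⟨hs, α', hα'⟩ := P.exists_polar hball
    refine ⟨e1, ⟨by linarith, hs.2⟩, α', hα', ?_⟩
    rw [← hα'] at h
    exact P.norm_dir_sub_le hR' hη hε hε' hs h
  rw [ha] at h1
  rw [hb] at h2
  obtain ⟨a1, a2, α', a3, a4⟩ := main _ _ h1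
  obtain ⟨b1, b2, β', b3, b4⟩ := main _ _ h2
  set s := dist p (y.1 (t - R)) with hs
  set s' := dist p (y.1 (t + R)) with hs'
  -- Each end changes its direction by at most `η / 4`.
  have hab : Real.pi + η / 2 ≤ ‖α' - β'‖ := by
    have : ‖α - β‖ ≤ ‖α - α'‖ + ‖α' - β'‖ + ‖β - β'‖ := by
      have e : α - β = (α - α') + (α' - β') - (β - β') := by abel
      calc ‖α - β‖ = ‖(α - α') + (α' - β') - (β - β')‖ := by rw [← e]
        _ ≤ ‖(α - α') + (α' - β')‖ + ‖β - β'‖ := norm_sub_le _ _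
        _ ≤ _ := by gcongr; exact norm_add_le _ _
    linarith
  have hab' : Real.pi ≤ ‖α' - β'‖ := by linarith
  have e : |t - R - (t + R)| = 2 * R := by
    rw [abs_sub_comm, abs_of_pos (by linarith)]; ring
  have hdist := hρ.dist_eq y (s := t - R) (t := t + R) (by rw [e]; exact hRρ)
  have hss : s + s' = 2 * R := by
    have h := P.dist_sq_polar ⟨a2.1.le, a2.2⟩ ⟨b2.1.le, b2.2⟩ α' β'
    rw [a3, b3, hdist, e, coneCos_of_pi_le hab'] at h
    have : (s + s') ^ 2 = (2 * R) ^ 2 := by linarith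
    have p1 := a2.1; have p2 := b2.1
    exact (pow_left_inj₀ (by positivity) (by positivity) two_ne_zero).1 this
  obtain ⟨a5, a6⟩ := abs_le.1 a1
  have q1 : t - R - (t - R + s) = -s := by ring
  have q2 : t + R - (t - R + s) = s' := by linarith
  have w1 : dist (y.1 (t - R)) (y.1 (t - R + s)) = s := by
    rw [hρ.dist_eq y] <;> rw [q1, abs_neg, abs_of_pos a2.1]
    linarith [b2.1]
  have w2 : dist (y.1 (t + R)) (y.1 (t - R + s)) = s' := by
    rw [hρ.dist_eq y] <;> rw [q2, abs_of_pos b2.1]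
    linarith [a2.1]
  have hτ : y.1 (t - R + s) = p := by
    have hball : y.1 (t - R + s) ∈ Metric.ball p P.radius := by
      rw [Metric.mem_ball, dist_comm]
      refine (dist_triangle _ (y.1 (t - R)) _).trans_lt ?_
      rw [w1]; linarith
    obtain ⟨hv, ζ, hζ⟩ := P.exists_polar hball
    set v := dist p (y.1 (t - R + s))
    have k1 := P.dist_sq_polar ⟨a2.1.le, a2.2⟩ hv α' ζ
    have k2 := P.dist_sq_polar ⟨b2.1.le, b2.2⟩ hv β' ζ
    rw [a3, hζ, w1] at k1
    rw [b3, hζ, w2] at k2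
    have k3 := coneCos_add_coneCos_nonpos hab' ζ
    -- Away from the apex, the law of cosines would make the angles from `ζ` to both ends have
    -- positive cosines, although their sum is at most `0`.
    have hv0 : v = 0 := by
      by_contra hne
      have hvp : 0 < v := lt_of_le_of_ne hv.1 (Ne.symm hne)
      have l1 : v = 2 * s * coneCos (α' - ζ) := mul_left_cancel₀ hne (by linarith)
      have l2 : v = 2 * s' * coneCos (β' - ζ) := mul_left_cancel₀ hne (by linarith)
      have l3 : 0 < coneCos (α' - ζ) := by
        by_contra! h
        nlinarith [a2.1]
      have l4 : 0 < coneCos (β' - ζ) := by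
        by_contra! h
        nlinarith [b2.1]
      linarith
    exact (dist_eq_zero.1 hv0).symm
  refine ⟨t - R + s, by rwa [show t - R + s - t = s - R by ring], hτ, ?_⟩
  obtain ⟨α₁, β₁, hr, -⟩ := hρ.exists_hasRays P hR' hRρ y hτ
  -- The rays of `y` at `p` are identified by comparing their points at radius `R / 2` with the
  -- points at times `t ∓ R`.
  have hR2 : R / 2 ∈ Icc 0 R := ⟨by linarith, by linarith⟩
  have hR2' : R / 2 ∈ Ioo 0 P.radius := ⟨by linarith, by linarith⟩
  obtain ⟨r1, r2⟩ := hr (R / 2) hR2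
  have hb5 := abs_le.1 b1
  have d1 : α₁ = α' := by
    apply P.polar_dir_unique hR2' a2
    have : t - R + s - R / 2 - (t - R) = -(R / 2 - s) := by ring
    rw [← r1, a3, hρ.dist_eq y] <;> rw [this, abs_neg]
    rw [abs_lt]; constructor <;> linarith
  have d2 : β₁ = β' := by
    apply P.polar_dir_unique hR2' b2
    have : t - R + s + R / 2 - (t + R) = R / 2 - s' := by linarith
    rw [← r2, b3, hρ.dist_eq y] <;> rw [this]
    rw [abs_lt]; constructor <;> linarith
  subst d1; subst d2
  exact ⟨α₁, β₁, hr, hab⟩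

/-! ### Homotopy of short paths, and rectifiable representatives. -/

section SimplyConnected

variable {S : Type*} [MetricSpace S]

namespace ConeChart

variable {p : S} {L : ℝ} (P : ConeChart p L)

/-- The direction of a point in polar coordinates. -/
def dir (x : Metric.ball p P.radius) : AddCircle L := (P.exists_polar x.2).2.choose

lemma polar_dir (x : Metric.ball p P.radius) : P.polar (dist p x.1) (P.dir x) = x.1 :=
  (P.exists_polar x.2).2.choose_spec

lemma mul_dist_mem (x : Metric.ball p P.radius) (u : unitInterval) :
    u.1 * dist p x.1 ∈ Ico 0 P.radius := by
  have h := (P.exists_polar x.2).1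
  refine ⟨mul_nonneg u.2.1 h.1, lt_of_le_of_lt ?_ h.2⟩
  exact mul_le_of_le_one_left h.1 u.2.2

/-- Scaling towards the apex. -/
def scale (u : unitInterval) (x : Metric.ball p P.radius) : Metric.ball p P.radius :=
  ⟨P.polar (u.1 * dist p x.1) (P.dir x), by
    rw [Metric.mem_ball, dist_comm, P.dist_center_polar (P.mul_dist_mem x u)]
    exact (P.mul_dist_mem x u).2⟩

lemma dist_scale_right (u : unitInterval) (x y : Metric.ball p P.radius) :
    dist (P.scale u x) (P.scale u y) = u.1 * dist x y := by
  have h1 := P.dist_sq_polar (P.mul_dist_mem x u) (P.mul_dist_mem y u) (P.dir x) (P.dir y)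
  have h2 := P.dist_sq_polar (P.exists_polar x.2).1 (P.exists_polar y.2).1 (P.dir x) (P.dir y)
  rw [P.polar_dir, P.polar_dir] at h2
  have h3 : dist (P.scale u x) (P.scale u y) ^ 2 = (u.1 * dist x y) ^ 2 := by
    rw [Subtype.dist_eq, Subtype.dist_eq, mul_pow, h2, scale, scale, h1]
    ring
  exact (pow_left_inj₀ dist_nonneg (mul_nonneg u.2.1 dist_nonneg) two_ne_zero).1 h3

lemma dist_scale_left (u v : unitInterval) (x : Metric.ball p P.radius) :
    dist (P.scale u x) (P.scale v x) ≤ P.radius * dist u v := by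
  have h1 := P.dist_sq_polar (P.mul_dist_mem x u) (P.mul_dist_mem x v) (P.dir x) (P.dir x)
  have h := (P.exists_polar x.2).1
  have h3 : dist (P.scale u x) (P.scale v x) ^ 2 = (dist p x.1 * dist u v) ^ 2 := by
    rw [Subtype.dist_eq, Subtype.dist_eq, Real.dist_eq, mul_pow, sq_abs, scale, scale, h1, sub_self,
      coneCos_zero]
    ring
  rw [(pow_left_inj₀ dist_nonneg (mul_nonneg h.1 dist_nonneg) two_ne_zero).1 h3]
  exact mul_le_mul_of_nonneg_right h.2.le dist_nonneg

/-- Scaling by `u` multiplies distances by `u`. The arbitrary choice of `dir` at the apex is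
harmless, as the law of cosines ignores directions at radius `0`. -/
lemma continuous_scale :
    Continuous fun q : unitInterval × Metric.ball p P.radius => P.scale q.1 q.2 := by
  refine (LipschitzWith.of_dist_le_mul (K := (1 + P.radius).toNNReal) fun q r => ?_).continuous
  have hR := P.radius_pos
  rw [Real.coe_toNNReal _ (by linarith)]
  refine (dist_triangle _ (P.scale q.1 r.2) _).trans ?_
  rw [P.dist_scale_right]
  have h1 := P.dist_scale_left q.1 r.1 r.2
  have h2 : dist q.1 r.1 ≤ dist q r := le_max_left _ _
  have h3 : dist q.2 r.2 ≤ dist q r := le_max_right _ _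
  have h4 : q.1.1 * dist q.2 r.2 ≤ dist q.2 r.2 :=
    mul_le_of_le_one_left dist_nonneg q.1.2.2
  nlinarith

lemma contractibleSpace_ball : ContractibleSpace (Metric.ball p P.radius) := by
  rw [contractible_iff_id_nullhomotopic]
  refine ⟨⟨p, Metric.mem_ball_self P.radius_pos⟩, ⟨
    { toFun := fun q => P.scale (unitInterval.symm q.1) q.2
      continuous_toFun := P.continuous_scale.comp
        ((unitInterval.continuous_symm.comp continuous_fst).prodMk continuous_snd)
      map_zero_left := fun x => ?_
      map_one_left := fun x => ?_ }⟩⟩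
  · apply Subtype.ext
    simp [scale, P.polar_dir]
  · apply Subtype.ext
    simp [scale, P.polar_zero]

/-- Paths inside a cone chart are homotopic. -/
lemma homotopic {a b : S} (c c' : Path a b) (hc : range c ⊆ Metric.ball p P.radius)
    (hc' : range c' ⊆ Metric.ball p P.radius) : c.Homotopic c' := by
  have := P.contractibleSpace_ball
  have ha : a ∈ Metric.ball p P.radius := hc ⟨0, c.source⟩
  have hb : b ∈ Metric.ball p P.radius := hc ⟨1, c.target⟩
  let d : Path (⟨a, ha⟩ : Metric.ball p P.radius) ⟨b, hb⟩ :=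
    { toFun := fun t => ⟨c t, hc ⟨t, rfl⟩⟩
      continuous_toFun := by fun_prop
      source' := Subtype.ext c.source
      target' := Subtype.ext c.target }
  let d' : Path (⟨a, ha⟩ : Metric.ball p P.radius) ⟨b, hb⟩ :=
    { toFun := fun t => ⟨c' t, hc' ⟨t, rfl⟩⟩
      continuous_toFun := by fun_prop
      source' := Subtype.ext c'.source
      target' := Subtype.ext c'.target }
  exact (SimplyConnectedSpace.paths_homotopic d d').map ⟨Subtype.val, continuous_subtype_val⟩

end ConeChart

/-- Paths with the same end points inside a ball of radius `ρ` are homotopic. -/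
def IsSimplyConnectedScale (S : Type*) [MetricSpace S] (ρ : ℝ) : Prop :=
  ∀ (q a b : S) (c c' : Path a b), (∀ t, dist q (c t) < ρ) → (∀ t, dist q (c' t) < ρ) →
    c.Homotopic c'

lemma ConeAtlas.isSimplyConnectedScale (A : ConeAtlas S) {ρ : ℝ}
    (h : ∀ q, ∃ p, Metric.ball q ρ ⊆ Metric.ball p (A.chart p).radius) :
    IsSimplyConnectedScale S ρ := by
  intro q a b c c' hc hc'
  obtain ⟨p, hp⟩ := h q
  refine (A.chart p).homotopic c c' ?_ ?_
  · rintro _ ⟨t, rfl⟩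
    exact hp (by rw [Metric.mem_ball, dist_comm]; exact hc t)
  · rintro _ ⟨t, rfl⟩
    exact hp (by rw [Metric.mem_ball, dist_comm]; exact hc' t)

/-- The straight path between two real numbers. -/
def linePath (s t : ℝ) : Path s t where
  toFun u := s + u * (t - s)
  continuous_toFun := by fun_prop
  source' := by simp
  target' := by simp

lemma linePath_mem (s t : ℝ) (u : unitInterval) : linePath s t u ∈ uIcc s t := by
  have e : linePath s t u = s + u * (t - s) := rfl
  have h0 := u.2.1
  have h1 := u.2.2
  rw [e, mem_uIcc]
  rcases le_total s t with h | h
  · left; constructor <;> nlinarith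
  · right; constructor <;> nlinarith

/-- The piece of the curve `g` between the times `s` and `t`. -/
def seg (g : C(ℝ, S)) (s t : ℝ) : Path (g s) (g t) := (linePath s t).map g.continuous

lemma seg_mem (g : C(ℝ, S)) (s t : ℝ) (u : unitInterval) : ∃ v ∈ uIcc s t, seg g s t u = g v :=
  ⟨_, linePath_mem s t u, rfl⟩

/-- Paths in `ℝ` with the same ends are homotopic, and `g` carries the homotopy over. -/
lemma mk_seg_trans (g : C(ℝ, S)) (s t u : ℝ) :
    (Path.Homotopic.Quotient.mk (seg g s t)).trans (.mk (seg g t u)) =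
      Path.Homotopic.Quotient.mk (seg g s u) := by
  rw [← Path.Homotopic.Quotient.mk_trans, Path.Homotopic.Quotient.eq]
  unfold seg
  rw [← Path.map_trans]
  exact (SimplyConnectedSpace.paths_homotopic _ _).map g

lemma mk_seg_self (g : C(ℝ, S)) (s : ℝ) :
    Path.Homotopic.Quotient.mk (seg g s s) = Path.Homotopic.Quotient.refl (g s) := by
  rw [← Path.Homotopic.Quotient.mk_refl, Path.Homotopic.Quotient.eq]
  exact (SimplyConnectedSpace.paths_homotopic (linePath s s) (Path.refl s)).map g

lemma pathLength_trans_le {x y z : S} (c : Path x y) (d : Path y z) :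
    pathLength (c.trans d) ≤ pathLength c + pathLength d := by
  set h : unitInterval := ⟨1 / 2, by norm_num, by norm_num⟩
  have hun : (univ : Set unitInterval) = Iic h ∪ Ici h := by rw [Iic_union_Ici]
  unfold pathLength
  nth_rw 1 [hun]
  rw [eVariationOn.union _ (x := h) isGreatest_Iic isLeast_Ici]
  gcongr
  · have e : EqOn (c.trans d) (c ∘ fun t => projIcc 0 1 zero_le_one (2 * t.1)) (Iic h) := by
      intro t ht
      have ht' : t.1 ≤ 1 / 2 := ht
      rw [← Path.extend_extends' (c.trans d) t, Path.extend_trans_of_le_half _ _ ht']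
      rfl
    rw [eVariationOn.congr e]
    exact eVariationOn.comp_le_of_monotoneOn _ _
      (fun a _ b _ hab => monotone_projIcc _ (by have : a.1 ≤ b.1 := hab; linarith))
      (fun _ _ => trivial)
  · have e : EqOn (c.trans d) (d ∘ fun t => projIcc 0 1 zero_le_one (2 * t.1 - 1)) (Ici h) := by
      intro t ht
      have ht' : 1 / 2 ≤ t.1 := ht
      rw [← Path.extend_extends' (c.trans d) t, Path.extend_trans_of_half_le _ _ ht']
      rfl
    rw [eVariationOn.congr e]
    exact eVariationOn.comp_le_of_monotoneOn _ _
      (fun a _ b _ hab => monotone_projIcc _ (by have : a.1 ≤ b.1 := hab; linarith))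
      (fun _ _ => trivial)

lemma pathLength_refl (x : S) : pathLength (Path.refl x) = 0 :=
  eVariationOn.constant_on (fun _ ⟨_, _, h⟩ _ ⟨_, _, h'⟩ => h.symm.trans h')

lemma pathLength_seg_le (γ : GS S) (s t : ℝ) :
    pathLength (seg ⟨γ.1, γ.continuous⟩ s t) ≤ ENNReal.ofReal |s - t| := by
  have hlip : LipschitzOnWith (Real.toNNReal |s - t|) (fun r => γ.1 (s + r * (t - s))) univ :=
    LipschitzOnWith.of_dist_le_mul fun u _ v _ => by
      refine (γ.dist_le _ _).trans (le_of_eq ?_)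
      have : s + u * (t - s) - (s + v * (t - s)) = (t - s) * (u - v) := by ring
      rw [this, abs_mul, abs_sub_comm t s, Real.dist_eq, Real.coe_toNNReal _ (abs_nonneg _)]
  have h1 := hlip.comp_eVariationOn_le (g := (Subtype.val : unitInterval → ℝ)) (s := univ)
    (fun _ _ => trivial)
  refine h1.trans ?_
  have hm : MonotoneOn (Subtype.val : unitInterval → ℝ) univ := fun _ _ _ _ h => h
  have h2 := hm.eVariationOn_eq (a := 0) (b := 1) trivial trivial
  have hu : (univ : Set unitInterval) ∩ Icc 0 1 = univ := by
    ext x; exact ⟨fun _ => trivial, fun _ => ⟨trivial, x.2.1, x.2.2⟩⟩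
  rw [hu] at h2
  rw [h2]
  simp [ENNReal.ofReal]

/-- Every homotopy class contains a path of finite length. -/
lemma IsSimplyConnectedScale.exists_pathLength_lt_top [IsFlatConeSurface S] {ρ : ℝ}
    (hρ : IsSimplyConnectedScale S ρ) (hρ0 : 0 < ρ) {x y : S} (q : Path.Homotopic.Quotient x y) :
    ∃ c : Path x y, Path.Homotopic.Quotient.mk c = q ∧ pathLength c < ⊤ := by
  induction q with | mk c =>
  set g : C(ℝ, S) := c.extend with hg
  have huc : UniformContinuousOn g (Icc 0 1) :=
    isCompact_Icc.uniformContinuousOn_of_continuous g.continuous.continuousOn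
  obtain ⟨h, hh, hgh⟩ := Metric.uniformContinuousOn_iff.1 huc (ρ / 4) (by linarith)
  have key := chain_of_small_steps (s := 0) (t := 1) (h := h / 2) (by linarith)
    (p := fun s => ∃ c' : Path (g 0) (g s),
      Path.Homotopic.Quotient.mk c' = Path.Homotopic.Quotient.mk (seg g 0 s) ∧
      pathLength c' < ⊤) ⟨Path.refl _, by rw [mk_seg_self]; rfl, by simp [pathLength_refl]⟩ ?_
  · obtain ⟨c', h1, h2⟩ := key
    have e0 : g 0 = x := c.extend_zero
    have e1 : g 1 = y := c.extend_one
    refine ⟨c'.cast e0.symm e1.symm, ?_, h2⟩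
    have e : c = (seg g 0 1).cast e0.symm e1.symm := by
      ext t
      simp [seg, linePath, hg]
    rw [e, Path.Homotopic.Quotient.mk_cast, Path.Homotopic.Quotient.mk_cast, h1]
  · rintro u hu v hv huv ⟨c', h1, h2⟩
    rw [uIcc_of_le zero_le_one] at hu hv
    -- A short piece of the path is replaced by an almost shortest one; both lie in the `ρ`-ball
    -- about `g u`.
    obtain ⟨d, hd⟩ := IsFlatConeSurface.length_metric (g u) (g v) (ρ / 4) (by linarith)
    have hguv : dist (g u) (g v) < ρ / 4 := hgh u hu v hv (by
      rw [Real.dist_eq, abs_sub_comm]; linarith)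
    have hhom : Path.Homotopic.Quotient.mk d = Path.Homotopic.Quotient.mk (seg g u v) := by
      rw [Path.Homotopic.Quotient.eq]
      refine hρ (g u) _ _ _ _ (fun t => ?_) (fun t => ?_)
      · have := dist_add_dist_le_of_pathLength_le hd (by positivity) t
        linarith [dist_nonneg (x := d t) (y := g v)]
      · obtain ⟨w, hw, hw'⟩ := seg_mem g u v t
        rw [hw']
        have hw01 : w ∈ Icc (0 : ℝ) 1 := by
          rw [mem_uIcc] at hw
          rcases hw with hw | hw
          · exact ⟨hu.1.trans hw.1, hw.2.trans hv.2⟩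
          · exact ⟨hv.1.trans hw.1, hw.2.trans hu.2⟩
        have : dist (g u) (g w) < ρ / 4 := hgh u hu w hw01 (by
          rw [Real.dist_eq, abs_sub_comm]
          linarith [abs_sub_left_of_mem_uIcc hw])
        linarith
    refine ⟨c'.trans d, ?_, ?_⟩
    · rw [Path.Homotopic.Quotient.mk_trans, h1, hhom, mk_seg_trans]
    · refine (pathLength_trans_le _ _).trans_lt (ENNReal.add_lt_top.2 ⟨h2, ?_⟩)
      exact hd.trans_lt ENNReal.ofReal_lt_top

end SimplyConnected

/-! ### Lifts to the universal cover and estimates for `d_GS`. -/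

section Cover

variable {S : Type*} [MetricSpace S] {x₀ : S} {ρ : ℝ}

namespace UniversalCover

/-- The paths in `S` whose lifts join two points of the universal cover. -/
abbrev PathsBetween (a b : UniversalCover S x₀) : Type _ :=
  {c : Path a.proj b.proj // a.cls.trans (Path.Homotopic.Quotient.mk c) = b.cls}

lemma dist_def (a b : UniversalCover S x₀) :
    dist a b = (⨅ c : PathsBetween a b, pathLength c.1).toReal := rfl

lemma dist_nonneg (a b : UniversalCover S x₀) : 0 ≤ dist a b := ENNReal.toReal_nonneg

lemma dist_le {a b : UniversalCover S x₀} (c : PathsBetween a b) {l : ℝ} (hl : 0 ≤ l)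
    (hc : pathLength c.1 ≤ ENNReal.ofReal l) : dist a b ≤ l :=
  ENNReal.toReal_le_of_le_ofReal hl ((iInf_le _ c).trans hc)

/-- `ENNReal.toReal` sends `⊤` to `0`, so finiteness is needed before `dist` can bound lengths. -/
lemma iInf_pathLength_lt_top [IsFlatConeSurface S] (hρ : IsSimplyConnectedScale S ρ) (hρ0 : 0 < ρ)
    (a b : UniversalCover S x₀) : ⨅ c : PathsBetween a b, pathLength c.1 < ⊤ := by
  obtain ⟨c, hc, hc'⟩ := hρ.exists_pathLength_lt_top hρ0 (a.cls.symm.trans b.cls)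
  refine lt_of_le_of_lt (iInf_le _ ⟨c, ?_⟩) hc'
  rw [hc, ← Path.Homotopic.Quotient.trans_assoc, Path.Homotopic.Quotient.trans_symm,
    Path.Homotopic.Quotient.refl_trans]

lemma exists_pathLength_le [IsFlatConeSurface S] (hρ : IsSimplyConnectedScale S ρ) (hρ0 : 0 < ρ)
    (a b : UniversalCover S x₀) {ε : ℝ} (hε : 0 < ε) :
    ∃ c : PathsBetween a b, pathLength c.1 ≤ ENNReal.ofReal (dist a b + ε) := by
  have hfin := iInf_pathLength_lt_top hρ hρ0 a b
  have : ⨅ c : PathsBetween a b, pathLength c.1 < ENNReal.ofReal (dist a b + ε) := by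
    rw [ENNReal.lt_ofReal_iff_toReal_lt hfin.ne, dist_def]
    linarith
  obtain ⟨c, hc⟩ := iInf_lt_iff.1 this
  exact ⟨c, hc.le⟩

lemma dist_proj_le [IsFlatConeSurface S] (hρ : IsSimplyConnectedScale S ρ) (hρ0 : 0 < ρ)
    (a b : UniversalCover S x₀) : dist a.proj b.proj ≤ dist a b := by
  refine le_of_forall_pos_le_add fun ε hε => ?_
  obtain ⟨c, hc⟩ := exists_pathLength_le hρ hρ0 a b hε
  have := dist_add_dist_le_of_pathLength_le hc (by linarith [dist_nonneg a b]) 1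
  simpa using this

lemma dist_triangle [IsFlatConeSurface S] (hρ : IsSimplyConnectedScale S ρ) (hρ0 : 0 < ρ)
    (a b c : UniversalCover S x₀) : dist a c ≤ dist a b + dist b c := by
  refine le_of_forall_pos_le_add fun ε hε => ?_
  obtain ⟨⟨d, hd⟩, hd'⟩ := exists_pathLength_le hρ hρ0 a b (half_pos hε)
  obtain ⟨⟨e, he⟩, he'⟩ := exists_pathLength_le hρ hρ0 b c (half_pos hε)
  have h1 := dist_nonneg a b
  have h2 := dist_nonneg b c
  refine dist_le ⟨d.trans e, ?_⟩ (by linarith) ?_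
  · rw [Path.Homotopic.Quotient.mk_trans, ← Path.Homotopic.Quotient.trans_assoc, hd, he]
  · refine (pathLength_trans_le d e).trans ((add_le_add hd' he').trans ?_)
    rw [← ENNReal.ofReal_add (by linarith) (by linarith)]
    exact ENNReal.ofReal_le_ofReal (by linarith)

end UniversalCover

open UniversalCover

lemma dist_le_of_isLocalIsometry [IsFlatConeSurface S] (hρ : IsSimplyConnectedScale S ρ)
    (hρ0 : 0 < ρ) {γ : ℝ → UniversalCover S x₀} (hγ : IsLocalIsometry γ) (s t : ℝ) :
    dist (γ s) (γ t) ≤ |s - t| :=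
  le_abs_sub_of_locally_le (D := fun s t => dist (γ s) (γ t))
    (fun _ _ _ => UniversalCover.dist_triangle hρ hρ0 _ _ _)
    (fun t => (hγ t).imp fun _ h => ⟨h.1, fun s hs s' hs' => (h.2 s hs s' hs').le⟩) s t

/-- A geodesic as a continuous map. -/
abbrev GS.toMap (γ : GS S) : C(ℝ, S) := ⟨γ.1, γ.continuous⟩

/-- The lift of a geodesic that starts in a given homotopy class. -/
def GS.lift (γ : GS S) (q : Path.Homotopic.Quotient x₀ (γ.1 0)) : ℝ → UniversalCover S x₀ :=
  fun s => ⟨γ.1 s, q.trans (Path.Homotopic.Quotient.mk (seg γ.toMap 0 s))⟩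

/-- The segment of `γ` lies in the right class and bounds the distance from above; projecting to `S`
bounds it from below. -/
lemma GS.isLift_lift [IsFlatConeSurface S] (hρ : IsSimplyConnectedScale S ρ)
    (hρ0 : 0 < ρ) (γ : GS S) (q : Path.Homotopic.Quotient x₀ (γ.1 0)) : IsLift (γ.lift q) γ := by
  refine ⟨fun t => ?_, fun s => rfl⟩
  obtain ⟨ε, hε, h⟩ := γ.2 t
  refine ⟨ε, hε, fun s hs s' hs' => le_antisymm ?_ ?_⟩
  · have hcls : (q.trans (.mk (seg γ.toMap 0 s))).trans (.mk (seg γ.toMap s s')) =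
        q.trans (.mk (seg γ.toMap 0 s')) := by
      rw [Path.Homotopic.Quotient.trans_assoc, mk_seg_trans]
    have hlen : pathLength (seg γ.toMap s s') ≤ ENNReal.ofReal |s - s'| := pathLength_seg_le γ s s'
    exact UniversalCover.dist_le (a := γ.lift q s) (b := γ.lift q s') ⟨seg γ.toMap s s', hcls⟩
      (abs_nonneg (s - s')) hlen
  · rw [← h s hs s' hs']
    exact UniversalCover.dist_proj_le hρ hρ0 (γ.lift q s) (γ.lift q s')

lemma exists_class [IsFlatConeSurface S] (x y : S) : Nonempty (Path.Homotopic.Quotient x y) :=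
  ⟨.mk (IsFlatConeSurface.length_metric x y 1 one_pos).choose⟩

/-- The hypothesis `h` says that an almost shortest `σ` closes a homotopically trivial square with
`σ₀` and the two geodesics, so that `σ` lifts to a path between the two lifts. -/
lemma GS.dist_lift_le [IsFlatConeSurface S] (x y : GS S) (q : Path.Homotopic.Quotient x₀ (x.1 0))
    (σ₀ : Path (x.1 0) (y.1 0)) {s e : ℝ} (he : 0 < e)
    (h : ∀ σ : Path (x.1 s) (y.1 s), pathLength σ ≤ ENNReal.ofReal (dist (x.1 s) (y.1 s) + e) →
      (Path.Homotopic.Quotient.mk (seg x.toMap 0 s)).trans (.mk σ) =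
        (Path.Homotopic.Quotient.mk σ₀).trans (.mk (seg y.toMap 0 s))) :
    dist (x.lift q s) (y.lift (q.trans (.mk σ₀)) s) ≤ dist (x.1 s) (y.1 s) := by
  refine le_of_forall_pos_le_add fun e' he' => ?_
  obtain ⟨σ, hσ⟩ := IsFlatConeSurface.length_metric (x.1 s) (y.1 s) (min e e') (lt_min he he')
  have h1 : pathLength σ ≤ ENNReal.ofReal (dist (x.1 s) (y.1 s) + e) :=
    hσ.trans (ENNReal.ofReal_le_ofReal (by linarith [min_le_left e e']))
  refine UniversalCover.dist_le ⟨σ, ?_⟩ (by positivity)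
    (hσ.trans (ENNReal.ofReal_le_ofReal (by linarith [min_le_right e e'])))
  simp only [GS.lift]
  rw [Path.Homotopic.Quotient.trans_assoc, Path.Homotopic.Quotient.trans_assoc, h σ h1]

/-- Two nearby geodesics have nearby lifts. -/
lemma GS.exists_lifts_dist_le [IsFlatConeSurface S] (hρ : IsSimplyConnectedScale S ρ) (hρ0 : 0 < ρ)
    (x₀ : S) (x y : GS S) {T : ℝ} (hT : 0 ≤ T)
    (hxy : ∀ s, |s| ≤ T → dist (x.1 s) (y.1 s) ≤ ρ / 10) :
    ∃ x' y' : ℝ → UniversalCover S x₀, IsLift x' x ∧ IsLift y' y ∧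
      ∀ s, |s| ≤ T → dist (x' s) (y' s) ≤ dist (x.1 s) (y.1 s) := by
  obtain ⟨q⟩ := exists_class x₀ (x.1 0)
  have hshort : ∀ s, |s| ≤ T → ∀ {e : ℝ} (σ : Path (x.1 s) (y.1 s)), 0 < e → e ≤ ρ / 10 →
      pathLength σ ≤ ENNReal.ofReal (dist (x.1 s) (y.1 s) + e) →
      ∀ t, dist (x.1 s) (σ t) ≤ ρ / 5 := by
    intro s hs e σ he he' hσ t
    have := dist_add_dist_le_of_pathLength_le hσ (by positivity) t
    have h2 := hxy s hs
    have h3 : 0 ≤ dist (σ t) (y.1 s) := _root_.dist_nonneg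
    linarith
  obtain ⟨σ₀, hσ₀⟩ := IsFlatConeSurface.length_metric (x.1 0) (y.1 0) (ρ / 10) (by linarith)
  refine ⟨x.lift q, y.lift (q.trans (.mk σ₀)), x.isLift_lift hρ hρ0 q, y.isLift_lift hρ hρ0 _,
    fun s hs => GS.dist_lift_le x y q σ₀ (e := ρ / 10) (by linarith) ?_⟩
  -- The square condition is propagated from time `0`: each small square has its sides in the
  -- `ρ`-ball about `x.1 u`.
  refine chain_of_small_steps (s := 0) (t := s) (h := ρ / 10) (by linarith)
    (p := fun s => ∀ σ : Path (x.1 s) (y.1 s),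
      pathLength σ ≤ ENNReal.ofReal (dist (x.1 s) (y.1 s) + ρ / 10) →
      (Path.Homotopic.Quotient.mk (seg x.toMap 0 s)).trans (.mk σ) =
        (Path.Homotopic.Quotient.mk σ₀).trans (.mk (seg y.toMap 0 s))) ?_ ?_
  · intro σ hσ
    rw [mk_seg_self, mk_seg_self]
    refine (Path.Homotopic.Quotient.refl_trans _).trans
      (Eq.trans ?_ (Path.Homotopic.Quotient.trans_refl _).symm)
    rw [Path.Homotopic.Quotient.eq]
    have h0 : |(0 : ℝ)| ≤ T := by simpa using hT
    exact hρ (x.1 0) _ _ _ _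
      (fun t => (hshort 0 h0 σ (by linarith) le_rfl hσ t).trans_lt (by linarith))
      (fun t => (hshort 0 h0 σ₀ (by linarith) le_rfl hσ₀ t).trans_lt (by linarith))
  · intro u hu v hv huv hp σ hσ
    have habs : ∀ w ∈ uIcc 0 s, |w| ≤ T := fun w hw => by
      have := abs_sub_left_of_mem_uIcc hw
      simp only [sub_zero] at this
      exact this.trans hs
    obtain ⟨σ', hσ'⟩ :=
      IsFlatConeSurface.length_metric (x.1 u) (y.1 u) (ρ / 10) (by linarith)
    have hhom : (Path.Homotopic.Quotient.mk (seg x.toMap u v)).trans (.mk σ) =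
        (Path.Homotopic.Quotient.mk σ').trans (.mk (seg y.toMap u v)) := by
      rw [← Path.Homotopic.Quotient.mk_trans, ← Path.Homotopic.Quotient.mk_trans,
        Path.Homotopic.Quotient.eq]
      have hstep : ∀ (z : GS S) (t : unitInterval), dist (z.1 u) (seg z.toMap u v t) ≤ ρ / 10 := by
        intro z t
        obtain ⟨w, hw, hw'⟩ := seg_mem z.toMap u v t
        rw [hw']
        refine (z.dist_le u w).trans ?_
        rw [abs_sub_comm]
        exact (abs_sub_left_of_mem_uIcc hw).trans huv
      refine hρ (x.1 u) _ _ _ _ (fun t => ?_) (fun t => ?_)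
      · have ht : (seg x.toMap u v).trans σ t ∈ range (seg x.toMap u v) ∪ range σ := by
          rw [← Path.trans_range]; exact ⟨t, rfl⟩
        rcases ht with ⟨t', ht'⟩ | ⟨t', ht'⟩
        · rw [← ht']; exact (hstep x t').trans_lt (by linarith)
        · rw [← ht']
          have h1 := hshort v (habs v hv) σ (by linarith) le_rfl hσ t'
          have h2 : dist (x.1 u) (x.1 v) ≤ ρ / 10 :=
            (x.dist_le u v).trans (by rwa [abs_sub_comm])
          linarith [_root_.dist_triangle (x.1 u) (x.1 v) (σ t')]
      · have ht : σ'.trans (seg y.toMap u v) t ∈ range σ' ∪ range (seg y.toMap u v) := by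
          rw [← Path.trans_range]; exact ⟨t, rfl⟩
        rcases ht with ⟨t', ht'⟩ | ⟨t', ht'⟩
        · rw [← ht']
          exact (hshort u (habs u hu) σ' (by linarith) le_rfl hσ' t').trans_lt (by linarith)
        · rw [← ht']
          have h1 := hstep y t'
          have h2 := hxy u (habs u hu)
          linarith [_root_.dist_triangle (x.1 u) (y.1 u) (seg y.toMap u v t')]
    have e1 := mk_seg_trans x.toMap 0 u v
    have e2 := mk_seg_trans y.toMap 0 u v
    rw [← e1, ← e2, Path.Homotopic.Quotient.trans_assoc]
    refine (congrArg _ hhom).trans ?_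
    rw [← Path.Homotopic.Quotient.trans_assoc, ← Path.Homotopic.Quotient.trans_assoc]
    exact congrArg (fun z => Path.Homotopic.Quotient.trans z _) (hp σ' hσ')

lemma integral_exp_neg_abs : ∫ s : ℝ, Real.exp (-|s|) = 2 := by
  rw [integral_comp_abs (f := fun s => Real.exp (-s)), integral_exp_neg_Ioi_zero, mul_one]

lemma integrable_exp_neg_abs : Integrable fun s : ℝ => Real.exp (-|s|) := by
  -- A non-integrable function has integral `0` by convention, whereas this integral is `2`.
  by_contra h
  have := integral_undef h
  rw [integral_exp_neg_abs] at this
  norm_num at this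

lemma distCover_nonneg (γ₁ γ₂ : ℝ → UniversalCover S x₀) : 0 ≤ distCover γ₁ γ₂ :=
  integral_nonneg fun _ => mul_nonneg (UniversalCover.dist_nonneg _ _) (Real.exp_pos _).le

lemma distGS_nonneg (x y : GS S) : 0 ≤ distGS x₀ x y :=
  Real.sInf_nonneg fun _ ⟨_, _, _, _, h⟩ => h ▸ distCover_nonneg _ _

lemma exp_mul_exp_neg_two (s : ℝ) : Real.exp |s| * Real.exp (-2 * |s|) = Real.exp (-|s|) := by
  rw [← Real.exp_add]; congr 1; ring

/-- A factor `exp |s|` leaves the integrable weight `exp (-|s|)` and dominates the linear divergence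
of lifts. -/
lemma distGS_le {x y : GS S} {x' y' : ℝ → UniversalCover S x₀} (hx : IsLift x' x)
    (hy : IsLift y' y) {C : ℝ} (h : ∀ s, dist (x' s) (y' s) ≤ C * Real.exp |s|) :
    distGS x₀ x y ≤ 2 * C := by
  have h1 : distGS x₀ x y ≤ distCover x' y' :=
    csInf_le ⟨0, fun _ ⟨_, _, _, _, h⟩ => h ▸ distCover_nonneg _ _⟩ ⟨x', y', hx, hy, rfl⟩
  refine h1.trans ?_
  have : ∫ s : ℝ, C * Real.exp (-|s|) = 2 * C := by
    rw [integral_const_mul, integral_exp_neg_abs, mul_comm]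
  rw [← this]
  refine integral_mono_of_nonneg
    (Eventually.of_forall fun _ => mul_nonneg (UniversalCover.dist_nonneg _ _) (Real.exp_pos _).le)
    (integrable_exp_neg_abs.const_mul C) (Eventually.of_forall fun s => ?_)
  simp only
  rw [← exp_mul_exp_neg_two, ← mul_assoc]
  exact mul_le_mul_of_nonneg_right (h s) (Real.exp_pos _).le

/-- Lifts diverge with speed at most `2`. -/
lemma dist_lifts_le [IsFlatConeSurface S] (hρ : IsSimplyConnectedScale S ρ) (hρ0 : 0 < ρ)
    {x y : GS S} {x' y' : ℝ → UniversalCover S x₀} (hx : IsLift x' x) (hy : IsLift y' y)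
    (s t : ℝ) : dist (x' s) (y' s) ≤ dist (x' t) (y' t) + 2 * |s - t| := by
  have h1 := UniversalCover.dist_triangle hρ hρ0 (x' s) (x' t) (y' s)
  have h2 := UniversalCover.dist_triangle hρ hρ0 (x' t) (y' t) (y' s)
  have h3 := dist_le_of_isLocalIsometry hρ hρ0 hx.1 s t
  have h4 := dist_le_of_isLocalIsometry hρ hρ0 hy.1 t s
  rw [abs_sub_comm] at h4
  linarith

/-- Geodesics that are close for a long time are close in `GS`. -/
lemma distGS_le_of_close [IsFlatConeSurface S] (hρ : IsSimplyConnectedScale S ρ) (hρ0 : 0 < ρ)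
    (x₀ : S) {x y : GS S} {T ε : ℝ} (hT : 0 ≤ T) (hε : ε ≤ ρ / 10)
    (hxy : ∀ s, |s| ≤ T → dist (x.1 s) (y.1 s) ≤ ε) :
    distGS x₀ x y ≤ 2 * (ε + 2 * Real.exp (-T)) := by
  obtain ⟨x', y', hx, hy, h⟩ :=
    GS.exists_lifts_dist_le hρ hρ0 x₀ x y hT fun s hs => (hxy s hs).trans hε
  have hε0 : 0 ≤ ε := le_trans _root_.dist_nonneg (hxy 0 (by simpa using hT))
  refine distGS_le hx hy fun s => ?_
  have e1 : (1 : ℝ) ≤ Real.exp |s| := Real.one_le_exp (abs_nonneg s)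
  have e2 := Real.exp_pos (-T)
  rcases le_or_gt |s| T with hs | hs
  · have := (h s hs).trans (hxy s hs)
    nlinarith [mul_pos e2 (Real.exp_pos |s|)]
  · have e3 : |s| - T ≤ Real.exp (-T) * Real.exp |s| := by
      rw [← Real.exp_add]
      linarith [Real.add_one_le_exp (-T + |s|)]
    have key : ∃ t, |t| ≤ T ∧ |s - t| = |s| - T := by
      rcases le_total 0 s with h0 | h0
      · rw [abs_of_nonneg h0] at hs ⊢
        exact ⟨T, by rw [abs_of_nonneg hT], by rw [abs_of_pos (by linarith)]⟩
      · rw [abs_of_nonpos h0] at hs ⊢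
        exact ⟨-T, by rw [abs_neg, abs_of_nonneg hT], by
          rw [abs_of_neg (by linarith)]; ring⟩
    obtain ⟨t, ht, hst⟩ := key
    have h1 := dist_lifts_le hρ hρ0 hx hy s t
    have h2 := (h t ht).trans (hxy t ht)
    rw [hst] at h1
    nlinarith

/-- Lifts can be chosen at distance at most `D + 1` at time `0`, and then `D + 1 + 2|s| ≤ (D + 3)
exp |s|`. -/
lemma exists_distGS_le [IsFlatConeSurface S] (hρ : IsSimplyConnectedScale S ρ) (hρ0 : 0 < ρ)
    (x₀ : S) : ∃ B, ∀ x y : GS S, distGS x₀ x y ≤ B := by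
  obtain ⟨D, hD⟩ := Metric.isBounded_iff.1 (isCompact_univ (X := S)).isBounded
  refine ⟨2 * (D + 3), fun x y => ?_⟩
  have hD' : dist (x.1 0) (y.1 0) ≤ D := hD trivial trivial
  have hD0 : 0 ≤ D := le_trans _root_.dist_nonneg hD'
  obtain ⟨q⟩ := exists_class x₀ (x.1 0)
  obtain ⟨σ, hσ⟩ := IsFlatConeSurface.length_metric (x.1 0) (y.1 0) 1 one_pos
  have hx := x.isLift_lift hρ hρ0 q
  have hy := y.isLift_lift hρ hρ0 (q.trans (.mk σ))
  have h0 : dist (x.lift q 0) (y.lift (q.trans (.mk σ)) 0) ≤ D + 1 := by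
    refine UniversalCover.dist_le ⟨σ, ?_⟩ (by linarith)
      (hσ.trans (ENNReal.ofReal_le_ofReal (by linarith)))
    simp only [GS.lift]
    rw [mk_seg_self, mk_seg_self]
    refine (congrArg (fun z => Path.Homotopic.Quotient.trans z _)
      (Path.Homotopic.Quotient.trans_refl q)).trans ?_
    exact (Path.Homotopic.Quotient.trans_refl _).symm
  refine distGS_le hx hy fun s => ?_
  have h1 := dist_lifts_le hρ hρ0 hx hy s 0
  rw [sub_zero] at h1
  have e1 : (1 : ℝ) ≤ Real.exp |s| := Real.one_le_exp (abs_nonneg s)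
  have e2 : |s| ≤ Real.exp |s| := by linarith [Real.add_one_le_exp |s|]
  nlinarith

/-- Geodesics that are close in `GS` are close at time `0`. -/
lemma exists_dist_le_of_distGS_le [IsFlatConeSurface S] (hρ : IsSimplyConnectedScale S ρ)
    (hρ0 : 0 < ρ) (x₀ : S) {ε : ℝ} (hε : 0 < ε) :
    ∃ δ > 0, ∀ x y : GS S, distGS x₀ x y ≤ δ → dist (x.1 0) (y.1 0) ≤ ε := by
  -- Lifts at distance at least `ε` at time `0` stay `ε / 2` apart for `|s| ≤ ε / 4`, where the
  -- weight is at least `exp (-ε / 2)`; this contributes at least `ε / 2 * k`.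
  set k := ε / 2 * Real.exp (-ε / 2) with hk
  have hkpos : 0 < k := by positivity
  have hcpos : 0 < ε / 2 * k := by positivity
  refine ⟨ε / 2 * k / 2, by linarith, fun x y hxy => ?_⟩
  obtain ⟨q⟩ := exists_class x₀ (x.1 0)
  obtain ⟨r⟩ := exists_class x₀ (y.1 0)
  obtain ⟨_, ⟨x', y', hx, hy, rfl⟩, hlt⟩ := exists_lt_of_csInf_lt
    (⟨_, _, _, x.isLift_lift hρ hρ0 q, y.isLift_lift hρ hρ0 r, rfl⟩ :
      {d : ℝ | ∃ γ₁' γ₂' : ℝ → UniversalCover S x₀,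
        IsLift γ₁' x ∧ IsLift γ₂' y ∧ d = distCover γ₁' γ₂'}.Nonempty)
    (show sInf _ < ε / 2 * k from lt_of_le_of_lt hxy (by linarith))
  by_contra! hgt
  have hD0 : ε ≤ dist (x' 0) (y' 0) := by
    have := UniversalCover.dist_proj_le hρ hρ0 (x' 0) (y' 0)
    rw [hx.2, hy.2] at this
    linarith
  set D := dist (x' 0) (y' 0)
  have hlip := dist_lifts_le hρ hρ0 hx hy
  have hcont : Continuous fun s => dist (x' s) (y' s) := by
    refine (LipschitzWith.of_dist_le_mul (K := 2) fun s t => ?_).continuous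
    rw [Real.dist_eq, Real.dist_eq, abs_le]
    have h1 := hlip s t
    have h2 := hlip t s
    rw [abs_sub_comm] at h2
    constructor <;> push_cast <;> linarith
  set F : ℝ → ℝ := fun s => dist (x' s) (y' s) * Real.exp (-2 * |s|) with hF
  have hF0 : ∀ s, 0 ≤ F s := fun s =>
    mul_nonneg (UniversalCover.dist_nonneg _ _) (Real.exp_pos _).le
  have hFint : Integrable F := by
    refine (integrable_exp_neg_abs.const_mul (D + 2)).mono' ?_ (Eventually.of_forall fun s => ?_)
    · exact (hcont.mul (by fun_prop)).aestronglyMeasurable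
    · rw [Real.norm_of_nonneg (hF0 s), ← exp_mul_exp_neg_two, ← mul_assoc]
      refine mul_le_mul_of_nonneg_right ?_ (Real.exp_pos _).le
      have h1 := hlip s 0
      rw [sub_zero] at h1
      have e1 : (1 : ℝ) ≤ Real.exp |s| := Real.one_le_exp (abs_nonneg s)
      have e2 : |s| ≤ Real.exp |s| := by linarith [Real.add_one_le_exp |s|]
      have : 0 ≤ D := by linarith
      nlinarith
  have hle : ∫ s, (Icc (-(ε / 4)) (ε / 4)).indicator (fun _ => k) s ≤ ∫ s, F s := by
    refine integral_mono ((integrable_indicator_iff measurableSet_Icc).2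
      (integrableOn_const (by simp))) hFint fun s => ?_
    by_cases hs : s ∈ Icc (-(ε / 4)) (ε / 4)
    · rw [indicator_of_mem hs]
      have habs : |s| ≤ ε / 4 := abs_le.2 hs
      refine mul_le_mul ?_ (Real.exp_le_exp.2 (by linarith)) (Real.exp_pos _).le
        (UniversalCover.dist_nonneg _ _)
      have h1 := hlip 0 s
      rw [zero_sub, abs_neg] at h1
      linarith
    · rw [indicator_of_notMem hs]
      exact hF0 s
  rw [integral_indicator_const _ measurableSet_Icc, Real.volume_real_Icc_of_le (by linarith),
    smul_eq_mul] at hle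
  have : (ε / 4 - -(ε / 4)) * k = ε / 2 * k := by ring
  rw [this] at hle
  exact absurd hlt (not_lt.2 hle)

end Cover

/-! ### Turning times, and geodesics that hardly turn. -/

section Turns

variable {S : Type*} [MetricSpace S]

/-- The geodesic `γ` turns at time `t` with an unsigned angle of at least `π + η`. -/
def TurnsBy (A : ConeAtlas S) (R η : ℝ) (γ : GS S) (t : ℝ) : Prop :=
  ∃ p, γ.1 t = p ∧ ∃ α β, HasRays (A.chart p) γ t R α β ∧ Real.pi + η ≤ ‖α - β‖

lemma TurnsBy.mono {A : ConeAtlas S} {R η η' : ℝ} {γ : GS S} {t : ℝ} (h : TurnsBy A R η γ t)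
    (hη : η' ≤ η) : TurnsBy A R η' γ t := by
  obtain ⟨p, hp, α, β, h1, h2⟩ := h
  exact ⟨p, hp, α, β, h1, by linarith⟩

lemma TurnsBy.of_flow {A : ConeAtlas S} {R η r : ℝ} {γ : GS S} {t : ℝ}
    (h : TurnsBy A R η (flow r γ) t) : TurnsBy A R η γ (t + r) := by
  obtain ⟨p, hp, α, β, h1, h2⟩ := h
  refine ⟨p, hp, α, β, fun u hu => ?_, h2⟩
  obtain ⟨k1, k2⟩ := h1 u hu
  rw [← k1, ← k2, show t + r - u = t - u + r by ring, show t + r + u = t + u + r by ring]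
  exact ⟨rfl, rfl⟩

lemma norm_le_pi {L : ℝ} (hL : L = 2 * Real.pi) (θ : AddCircle L) : ‖θ‖ ≤ Real.pi := by
  subst hL
  have := AddCircle.norm_le_half_period (2 * Real.pi) (x := θ) Real.two_pi_pos.ne'
  rw [abs_of_pos Real.two_pi_pos] at this
  linarith

/-- A radius adapted to all cone points. -/
def ConeAtlas.IsRadius (A : ConeAtlas S) (R : ℝ) : Prop :=
  0 < R ∧ ∀ p, A.angle p ≠ 2 * Real.pi → 4 * R < (A.chart p).radius

lemma ConeAtlas.exists_isRadius (A : ConeAtlas S) {ρ : ℝ} (hρ : 0 < ρ) :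
    ∃ R, A.IsRadius R ∧ 2 * R < ρ := by
  have h1 : ∀ᶠ R in 𝓝[>] (0 : ℝ), ∀ p ∈ {p | A.angle p ≠ 2 * Real.pi},
      4 * R < (A.chart p).radius := by
    rw [eventually_all_finite A.finite_cone_points]
    intro p _
    filter_upwards [Ioo_mem_nhdsGT (show 0 < (A.chart p).radius / 4 by
      have := (A.chart p).radius_pos; positivity)] with R hR
    linarith [hR.2]
  have h2 : ∀ᶠ R in 𝓝[>] (0 : ℝ), R ∈ Ioo 0 (ρ / 2) := Ioo_mem_nhdsGT (by positivity)
  obtain ⟨R, hR1, hR2⟩ := (h1.and h2).exists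
  exact ⟨R, ⟨hR2.1, hR1⟩, by linarith [hR2.2]⟩

/-- The precision with which a geodesic has to be followed to be forced through a cone point at
which it turns by `π + η`. -/
def passScale (R η : ℝ) : ℝ := min (R / 2) (R * min η Real.pi / (4 * Real.pi))

lemma passScale_pos {R η : ℝ} (hR : 0 < R) (hη : 0 < η) : 0 < passScale R η := by
  have := Real.pi_pos
  have : 0 < min η Real.pi := lt_min hη this
  exact lt_min (by positivity) (by positivity)

variable {A : ConeAtlas S} {ρ R : ℝ}

lemma TurnsBy.exists_pass (hρ : IsBruhatTitsScale S ρ) (hR : A.IsRadius R) (hRρ : 2 * R < ρ)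
    {x y : GS S} {t η ε : ℝ} (hη : 0 < η) (hx : TurnsBy A R η x t) (hε : ε ≤ passScale R η)
    (h1 : dist (x.1 (t - R)) (y.1 (t - R)) ≤ ε) (h2 : dist (x.1 (t + R)) (y.1 (t + R)) ≤ ε) :
    ∃ τ, |τ - t| ≤ ε ∧ y.1 τ = x.1 t ∧ TurnsBy A R (η / 2) y τ := by
  obtain ⟨p, hp, α, β, hr, hαβ⟩ := hx
  -- Directions at a point of angle `2π` are at most `π` apart, so the turn occurs at a cone point,
  -- where `R` fits the chart.
  have hcone : A.angle p ≠ 2 * Real.pi := fun h => by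
    linarith [norm_le_pi h (α - β)]
  obtain ⟨τ, e1, e2, α', β', e3, e4⟩ := hρ.exists_pass (A.chart p) hR.1 (hR.2 p hcone) hRρ hr hη hαβ
    (hε.trans (min_le_left _ _)) (hε.trans (min_le_right _ _)) h1 h2
  exact ⟨τ, e1, e2.trans hp.symm, p, e2, α', β', e3, e4⟩

/-- Turning angles are always at least `π`. At angle `2π` they cannot be larger, and at a cone point
an excess would be an excluded turn. `R` is adapted to the cone points only, hence the separate
radius `R'` elsewhere. -/
lemma mem_Sing_of_forall_not_turnsBy (hρ : IsBruhatTitsScale S ρ) (hR : A.IsRadius R)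
    (hRρ : 2 * R < ρ) {γ : GS S} (h : ∀ t, ∀ η > 0, ¬TurnsBy A R η γ t) : γ ∈ Sing S := by
  have hπ := Real.pi_pos
  intro t
  by_cases hcone : A.angle (γ.1 t) = 2 * Real.pi
  · set R' := min ((A.chart (γ.1 t)).radius / 2) (ρ / 4)
    have hrad := (A.chart (γ.1 t)).radius_pos
    have hR0 := hR.1
    have hR'0 : 0 < R' := lt_min (by positivity) (by linarith)
    have hR'1 : R' ≤ (A.chart (γ.1 t)).radius / 2 := min_le_left _ _
    have hR'2 : R' ≤ ρ / 4 := min_le_right _ _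
    obtain ⟨α, β, hr, hab⟩ := hρ.exists_hasRays (A.chart (γ.1 t)) (R := R') ⟨hR'0, by linarith⟩
      (by linarith) γ rfl
    exact ⟨_, A.chart (γ.1 t), α, β, le_antisymm (norm_le_pi hcone _) hab, R', hR'0, by linarith,
      fun u hu => hr u ⟨hu.1, hu.2.le⟩⟩
  · have hrad := hR.2 _ hcone
    have hR0 := hR.1
    obtain ⟨α, β, hr, hab⟩ := hρ.exists_hasRays (A.chart (γ.1 t)) (R := R) ⟨hR0, by linarith⟩
      hRρ γ rfl
    rcases hab.eq_or_lt with hab | hab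
    · exact ⟨_, A.chart (γ.1 t), α, β, hab.symm, R, hR0, by linarith,
        fun u hu => hr u ⟨hu.1, hu.2.le⟩⟩
    · exact absurd ⟨_, rfl, α, β, hr, by linarith⟩ (h t (‖α - β‖ - Real.pi) (by linarith))

/-- Every sequence of geodesics has a limit along a nonprincipal ultrafilter, uniformly on
bounded intervals. -/
lemma IsBruhatTitsScale.exists_limit [CompactSpace S] (hρ : IsBruhatTitsScale S ρ) (hρ0 : 0 < ρ)
    (x : ℕ → GS S) : ∃ z : GS S, ∀ T : ℝ, ∀ ε > 0, ∀ᶠ n in (hyperfilter ℕ : Filter ℕ),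
      ∀ s, |s| ≤ T → dist ((x n).1 s) (z.1 s) ≤ ε := by
  have hlim : ∀ s : ℝ, ∃ w : S, Tendsto (fun n => (x n).1 s) (hyperfilter ℕ) (𝓝 w) := by
    intro s
    obtain ⟨w, -, hw⟩ := (isCompact_univ (X := S)).ultrafilter_le_nhds
      ((hyperfilter ℕ).map fun n => (x n).1 s) (by simp)
    exact ⟨w, hw⟩
  choose w hw using hlim
  -- The isometry scale `ρ` is common to all geodesics, so it survives the pointwise limit; the
  -- `1`-Lipschitz bound makes convergence locally uniform.
  have hdist : ∀ s t, |s - t| < ρ → dist (w s) (w t) = |s - t| := by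
    intro s t hst
    refine tendsto_nhds_unique ((hw s).dist (hw t)) ?_
    simp only [fun n => hρ.dist_eq (x n) hst]
    exact tendsto_const_nhds
  have hiso : IsLocalIsometry w := by
    intro t
    refine ⟨ρ / 2, by linarith, fun s hs s' hs' => hdist s s' ?_⟩
    rw [abs_lt]; constructor <;> linarith [hs.1, hs.2, hs'.1, hs'.2]
  refine ⟨⟨w, hiso⟩, fun T ε hε => ?_⟩
  obtain ⟨F, -, hF, hcov⟩ := (isCompact_Icc (a := -T) (b := T)).finite_cover_balls
    (e := ε / 3) (by linarith)
  have hev : ∀ᶠ n in (hyperfilter ℕ : Filter ℕ), ∀ s ∈ F, dist ((x n).1 s) (w s) < ε / 3 := by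
    rw [eventually_all_finite hF]
    exact fun s _ => (Metric.tendsto_nhds.1 (hw s)) _ (by linarith)
  filter_upwards [hev] with n hn s hs
  obtain ⟨i, hi, his⟩ := mem_iUnion₂.1 (hcov (abs_le.1 hs : s ∈ Icc (-T) T))
  rw [Metric.mem_ball, Real.dist_eq] at his
  have h1 := (x n).dist_le s i
  have h2 := GS.dist_le ⟨w, hiso⟩ i s
  rw [abs_sub_comm] at h2
  have h3 := hn i hi
  have h4 := dist_triangle4 ((x n).1 s) ((x n).1 i) (w i) (w s)
  have h2' : dist (w i) (w s) ≤ |s - i| := h2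
  change dist ((x n).1 s) (w s) ≤ ε
  linarith

lemma exists_close_imp_distGS_lt [IsFlatConeSurface S] (hs : IsSimplyConnectedScale S ρ)
    (hρ0 : 0 < ρ) (x₀ : S) {δ : ℝ} (hδ : 0 < δ) :
    ∃ T : ℝ, ∃ ε > 0, ∀ x y : GS S, (∀ s, |s| ≤ T → dist (x.1 s) (y.1 s) ≤ ε) →
      distGS x₀ x y < δ := by
  have h1 : Tendsto (fun T : ℝ => Real.exp (-T)) atTop (𝓝 0) :=
    Real.tendsto_exp_neg_atTop_nhds_zero
  obtain ⟨T, hT1, hT2⟩ := ((h1.eventually (gt_mem_nhds (show 0 < δ / 8 by positivity))).and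
    (eventually_ge_atTop 0)).exists
  refine ⟨T, min (ρ / 10) (δ / 8), lt_min (by positivity) (by positivity), fun x y h => ?_⟩
  refine (distGS_le_of_close hs hρ0 x₀ hT2 (min_le_left _ _) h).trans_lt ?_
  linarith [min_le_right (ρ / 10) (δ / 8)]

/-- A potential that is locally constant near the singular geodesics takes the same value at two
nearby geodesics that do not turn much for a long time. -/
lemma exists_eq_of_not_turnsBy [IsFlatConeSurface S] (hρ : IsBruhatTitsScale S ρ)
    (hs : IsSimplyConnectedScale S ρ) (hρ0 : 0 < ρ) (hR : A.IsRadius R) (hRρ : 2 * R < ρ)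
    {x₀ : S} {φ : GS S → ℝ} {δ : ℝ} (hδ : 0 < δ)
    (hloc : IsLocallyConstantOn x₀ φ (nbhdSing x₀ δ)) :
    ∃ T > 0, ∃ η > 0, ∃ ε > 0, ∀ x y : GS S, (∀ s, |s| ≤ T → ¬TurnsBy A R η x s) →
      (∀ s, |s| ≤ T → dist (x.1 s) (y.1 s) ≤ ε) → φ x = φ y := by
  -- Counterexamples with `T → ∞` and `η, ε → 0` would converge to one singular geodesic, near which
  -- `φ` is constant.
  by_contra! hcon
  have hseq : ∀ n : ℕ, ∃ x y : GS S,
      (∀ s, |s| ≤ (n : ℝ) + 1 → ¬TurnsBy A R (1 / ((n : ℝ) + 1)) x s) ∧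
      (∀ s, |s| ≤ (n : ℝ) + 1 → dist (x.1 s) (y.1 s) ≤ 1 / ((n : ℝ) + 1)) ∧ φ x ≠ φ y := fun n =>
    hcon (n + 1) (by positivity) (1 / (n + 1)) (by positivity) (1 / (n + 1)) (by positivity)
  choose x y hturn hxy hne using hseq
  obtain ⟨z, hz⟩ := hρ.exists_limit hρ0 x
  have hlarge : ∀ c : ℝ, ∀ᶠ n : ℕ in (hyperfilter ℕ : Filter ℕ), c ≤ (n : ℝ) + 1 := fun c => by
    have h : ∀ᶠ n : ℕ in atTop, c ≤ (n : ℝ) :=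
      tendsto_natCast_atTop_atTop.eventually (eventually_ge_atTop c)
    filter_upwards [Nat.hyperfilter_le_atTop h] with n hn
    linarith
  have hsmall : ∀ c : ℝ, 0 < c → ∀ᶠ n : ℕ in (hyperfilter ℕ : Filter ℕ),
      1 / ((n : ℝ) + 1) ≤ c := fun c hc => by
    filter_upwards [hlarge (1 / c)] with n hn
    rw [div_le_iff₀ (by positivity)]
    rw [div_le_iff₀ hc] at hn
    linarith
  have hsing : z ∈ Sing S := by
    -- A turn of the limit by `η` would force `x n` to turn by `η / 2` at a nearby time.
    refine mem_Sing_of_forall_not_turnsBy hρ hR hRρ fun t η hη hzt => ?_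
    have hp := passScale_pos hR.1 hη
    have hR0 := hR.1
    obtain ⟨n, h1, h2, h3⟩ := ((hz (|t| + R) _ hp).and
      ((hlarge (|t| + passScale R η)).and (hsmall (η / 2) (by linarith)))).exists
    obtain ⟨τ, hτ, -, hτ'⟩ := hzt.exists_pass (y := x n) hρ hR hRρ hη le_rfl
      (by rw [dist_comm]; exact h1 _ ((abs_sub _ _).trans (by rw [abs_of_pos hR0])))
      (by rw [dist_comm]; exact h1 _ ((abs_add_le _ _).trans (by rw [abs_of_pos hR0])))
    refine hturn n τ ?_ (hτ'.mono h3)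
    have := abs_add_le (τ - t) t
    rw [sub_add_cancel] at this
    linarith
  obtain ⟨T₁, ε₁, hε₁, hclose₁⟩ := exists_close_imp_distGS_lt hs hρ0 x₀ hδ
  have hmem : z ∈ nbhdSing x₀ δ := ⟨z, hsing, hclose₁ z z fun s _ => by simp [hε₁.le]⟩
  obtain ⟨η₀, hη₀, hconst⟩ := hloc z hmem
  obtain ⟨T₂, ε₂, hε₂, hclose₂⟩ := exists_close_imp_distGS_lt hs hρ0 x₀ hη₀
  set T := max T₁ T₂
  set ε := min ε₁ ε₂
  have hε : 0 < ε := lt_min hε₁ hε₂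
  have key : ∀ w : GS S, (∀ s, |s| ≤ T → dist (w.1 s) (z.1 s) ≤ ε) → φ w = φ z := by
    intro w hw
    refine hconst w ⟨z, hsing, hclose₁ w z fun s hs => ?_⟩ (hclose₂ z w fun s hs => ?_)
    · exact (hw s (hs.trans (le_max_left _ _))).trans (min_le_left _ _)
    · rw [dist_comm]
      exact (hw s (hs.trans (le_max_right _ _))).trans (min_le_right _ _)
  obtain ⟨n, h1, h2, h3⟩ := ((hz T (ε / 2) (by linarith)).and
    ((hlarge T).and (hsmall (ε / 2) (by linarith)))).exists
  refine hne n ((key (x n) fun s hs => (h1 s hs).trans (by linarith)).trans (key (y n) ?_).symm)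
  intro s hs
  have e1 := h1 s hs
  have e2 := hxy n s (hs.trans h2)
  rw [dist_comm] at e2
  linarith [dist_triangle ((y n).1 s) ((x n).1 s) (z.1 s)]

end Turns

/-! ### Integral estimates and the Bowen property. -/

section Bowen

/-- The integral of a function that vanishes away from the ends of the interval. -/
lemma abs_integral_le_of_eq_zero {f : ℝ → ℝ} (hf : Continuous f) {V m p q : ℝ} (hV : ∀ r, |f r| ≤ V)
    (hm : 0 ≤ m) (hpq : p ≤ q) (h0 : ∀ r, p + m ≤ r → r ≤ q - m → f r = 0) :
    |∫ r in p..q, f r| ≤ 2 * m * V := by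
  have hV0 : 0 ≤ V := (abs_nonneg _).trans (hV 0)
  have hint : ∀ a b, IntervalIntegrable f volume a b := fun a b => hf.intervalIntegrable a b
  have hb : ∀ a b, a ≤ b → |∫ r in a..b, f r| ≤ V * (b - a) := fun a b hab => by
    have := intervalIntegral.norm_integral_le_of_norm_le_const (a := a) (b := b) (f := f) (C := V)
      fun r _ => hV r
    rwa [Real.norm_eq_abs, abs_of_nonneg (sub_nonneg.2 hab)] at this
  rcases le_or_gt (q - p) (2 * m) with h | h
  · refine (hb p q hpq).trans ?_
    nlinarith
  · have e : ∫ r in p..q, f r = (∫ r in p..(p + m), f r) + (∫ r in (p + m)..(q - m), f r)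
        + ∫ r in (q - m)..q, f r := by
      rw [intervalIntegral.integral_add_adjacent_intervals (hint _ _) (hint _ _),
        intervalIntegral.integral_add_adjacent_intervals (hint _ _) (hint _ _)]
    have hz : ∫ r in (p + m)..(q - m), f r = 0 := by
      refine (intervalIntegral.integral_congr (g := fun _ => (0 : ℝ)) fun r hr => ?_).trans (by simp)
      rw [uIcc_of_le (by linarith)] at hr
      exact h0 r hr.1 hr.2
    rw [e, hz, add_zero]
    have h1 := hb p (p + m) (by linarith)
    have h2 := hb (q - m) q (by linarith)
    have := abs_add_le (∫ r in p..(p + m), f r) (∫ r in (q - m)..q, f r)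
    linarith

lemma integral_exp_add_exp_le {α a b : ℝ} (hα : 0 < α) :
    ∫ r in a..b, (Real.exp (-α * (r - a)) + Real.exp (-α * (b - r))) ≤ 2 / α := by
  have hd : ∀ r ∈ uIcc a b, HasDerivAt
      (fun r => (-Real.exp (-α * (r - a)) + Real.exp (-α * (b - r))) / α)
      (Real.exp (-α * (r - a)) + Real.exp (-α * (b - r))) r := by
    intro r _
    have h1 : HasDerivAt (fun r => -α * (r - a)) (-α) r := by
      simpa using ((hasDerivAt_id r).sub_const a).const_mul (-α)
    have h2 : HasDerivAt (fun r => -α * (b - r)) α r := by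
      simpa using ((hasDerivAt_id r).const_sub b).const_mul (-α)
    convert! (h1.exp.neg.add h2.exp).div_const α using 1
    field_simp
  rw [intervalIntegral.integral_eq_sub_of_hasDerivAt hd
    (Continuous.intervalIntegrable (by fun_prop) _ _), ← sub_div]
  gcongr
  simp only [sub_self, mul_zero, Real.exp_zero]
  linarith [Real.exp_pos (-α * (b - a))]

/-- The overlap of `[a, b]` and its translate cancels, leaving two pieces of length `|c|` on which
only the oscillation of `G` matters. -/
lemma abs_integral_shift_sub_le {G : ℝ → ℝ} (hG : Continuous G) {V : ℝ}
    (hV : ∀ r s, |G r - G s| ≤ V) (a b c : ℝ) :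
    |∫ r in a..b, (G (r + c) - G r)| ≤ V * |c| := by
  have hint : ∀ a b, IntervalIntegrable G volume a b := fun a b => hG.intervalIntegrable a b
  have hGc : Continuous fun r => G (r + c) := by fun_prop
  have e : ∫ r in a..b, (G (r + c) - G r) = ∫ u in (0 : ℝ)..c, (G (u + b) - G (u + a)) := by
    rw [intervalIntegral.integral_sub (hGc.intervalIntegrable _ _) (hint _ _),
      intervalIntegral.integral_sub (Continuous.intervalIntegrable (by fun_prop) _ _)
        (Continuous.intervalIntegrable (by fun_prop) _ _),
      intervalIntegral.integral_comp_add_right, intervalIntegral.integral_comp_add_right,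
      intervalIntegral.integral_comp_add_right, zero_add, zero_add, add_comm c b, add_comm c a]
    have h1 :=
      intervalIntegral.integral_add_adjacent_intervals (hint a (a + c)) (hint (a + c) (b + c))
    have h2 := intervalIntegral.integral_add_adjacent_intervals (hint a b) (hint b (b + c))
    linarith
  rw [e]
  have := intervalIntegral.norm_integral_le_of_norm_le_const (a := 0) (b := c)
    (f := fun u => G (u + b) - G (u + a)) (C := V) fun r _ => hV _ _
  rwa [Real.norm_eq_abs, sub_zero] at this

variable {S : Type*} [MetricSpace S] [IsFlatConeSurface S] {x₀ : S} {φ : GS S → ℝ} {ρ : ℝ}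

/-- Hölder potentials have bounded oscillation. -/
lemma IsHolder.exists_abs_sub_le (hφ : IsHolder x₀ φ) (hs : IsSimplyConnectedScale S ρ)
    (hρ0 : 0 < ρ) : ∃ V, 0 ≤ V ∧ ∀ x y, |φ x - φ y| ≤ V := by
  obtain ⟨C, α, hα, h⟩ := hφ
  obtain ⟨B, hB⟩ := exists_distGS_le hs hρ0 x₀
  refine ⟨|C| * max B 0 ^ α, by positivity, fun x y => (h x y).trans ?_⟩
  have h0 := distGS_nonneg (x₀ := x₀) x y
  exact mul_le_mul (le_abs_self C)
    (Real.rpow_le_rpow h0 ((hB x y).trans (le_max_left _ _)) hα.le)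
    (Real.rpow_nonneg h0 _) (abs_nonneg C)

/-- Hölder potentials are continuous along the orbits of the geodesic flow. -/
lemma IsHolder.continuous_flow (hφ : IsHolder x₀ φ) (hs : IsSimplyConnectedScale S ρ)
    (hρ0 : 0 < ρ) (x : GS S) : Continuous fun r => φ (flow r x) := by
  obtain ⟨C, α, hα, h⟩ := hφ
  have hd : ∀ r r' : ℝ, |r - r'| ≤ ρ / 10 → distGS x₀ (flow r x) (flow r' x) ≤ 2 * |r - r'| := by
    intro r r' hr
    have h1 : Tendsto (fun T : ℝ => 2 * (|r - r'| + 2 * Real.exp (-T))) atTop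
        (𝓝 (2 * (|r - r'| + 2 * 0))) :=
      ((Real.tendsto_exp_neg_atTop_nhds_zero.const_mul 2).const_add _).const_mul 2
    rw [mul_zero, add_zero] at h1
    refine ge_of_tendsto h1 ?_
    filter_upwards [eventually_ge_atTop 0] with T hT
    refine distGS_le_of_close hs hρ0 x₀ hT hr fun s _ => ?_
    refine (x.dist_le (s + r) (s + r')).trans ?_
    rw [add_sub_add_left_eq_sub]
  rw [continuous_iff_continuousAt]
  intro r
  rw [ContinuousAt, tendsto_iff_dist_tendsto_zero]
  have hlim : Tendsto (fun r' => |C| * (2 * |r' - r|) ^ α) (𝓝 r) (𝓝 0) := by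
    have hc : Continuous fun r' => |C| * (2 * |r' - r|) ^ α :=
      continuous_const.mul (Continuous.rpow_const (by fun_prop) fun _ => Or.inr hα.le)
    simpa [hα.ne'] using hc.tendsto r
  refine squeeze_zero' (Eventually.of_forall fun _ => dist_nonneg) ?_ hlim
  filter_upwards [Metric.closedBall_mem_nhds r (show 0 < ρ / 10 by positivity)] with r' hr'
  rw [Metric.mem_closedBall, Real.dist_eq] at hr'
  rw [Real.dist_eq]
  have h0 := distGS_nonneg (x₀ := x₀) (flow r' x) (flow r x)
  exact (h _ _).trans (mul_le_mul (le_abs_self C) (Real.rpow_le_rpow h0 (hd r' r hr') hα.le)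
    (Real.rpow_nonneg h0 _) (abs_nonneg C))

/-- The integrals of a Hölder potential along two geodesics that coincide on an interval. -/
lemma IsHolder.exists_abs_integral_le (hφ : IsHolder x₀ φ) (hs : IsSimplyConnectedScale S ρ)
    (hρ0 : 0 < ρ) : ∃ K, 0 ≤ K ∧ ∀ (x y : GS S) (a b c : ℝ), a ≤ b →
      (∀ s ∈ Icc a b, x.1 s = y.1 (s + c)) →
      |∫ r in a..b, (φ (flow r x) - φ (flow (r + c) y))| ≤ K := by
  have hcont := fun x => hφ.continuous_flow hs hρ0 x
  obtain ⟨C, α, hα, h⟩ := hφ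
  refine ⟨|C| * 4 ^ α * (2 / α), by positivity, fun x y a b c hab hxy => ?_⟩
  have hbound : ∀ r ∈ Icc a b, |φ (flow r x) - φ (flow (r + c) y)| ≤
      |C| * 4 ^ α * (Real.exp (-α * (r - a)) + Real.exp (-α * (b - r))) := by
    intro r hr
    set T := min (r - a) (b - r) with hT
    have hT0 : 0 ≤ T := le_min (by linarith [hr.1]) (by linarith [hr.2])
    -- The two flowed geodesics agree on `[-T, T]`, where `T` is the time to the nearer end.
    have hd : distGS x₀ (flow r x) (flow (r + c) y) ≤ 4 * Real.exp (-T) := by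
      have := distGS_le_of_close hs hρ0 x₀ (x := flow r x) (y := flow (r + c) y) (ε := 0) hT0
        (by positivity) fun s hs => ?_
      · linarith
      · have hsT := abs_le.1 hs
        have e1 : T ≤ r - a := min_le_left _ _
        have e2 : T ≤ b - r := min_le_right _ _
        have := hxy (s + r) ⟨by linarith, by linarith⟩
        change dist (x.1 (s + r)) (y.1 (s + (r + c))) ≤ 0
        rw [this, add_assoc, dist_self]
    have h0 := distGS_nonneg (x₀ := x₀) (flow r x) (flow (r + c) y)
    refine (h _ _).trans ?_
    have e3 : distGS x₀ (flow r x) (flow (r + c) y) ^ α ≤ 4 ^ α * Real.exp (-α * T) := by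
      refine (Real.rpow_le_rpow h0 hd hα.le).trans (le_of_eq ?_)
      rw [Real.mul_rpow (by norm_num) (Real.exp_pos _).le, ← Real.exp_mul]
      congr 2; ring
    have e4 : Real.exp (-α * T) ≤ Real.exp (-α * (r - a)) + Real.exp (-α * (b - r)) := by
      rcases min_choice (r - a) (b - r) with h | h <;> rw [hT, h]
      · linarith [Real.exp_pos (-α * (b - r))]
      · linarith [Real.exp_pos (-α * (r - a))]
    rw [mul_assoc]
    refine mul_le_mul (le_abs_self C) (e3.trans ?_) (Real.rpow_nonneg h0 _) (abs_nonneg C)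
    exact mul_le_mul_of_nonneg_left e4 (by positivity)
  have hc1 : Continuous fun r => φ (flow r x) - φ (flow (r + c) y) :=
    (hcont x).sub ((hcont y).comp (continuous_add_const c))
  calc |∫ r in a..b, (φ (flow r x) - φ (flow (r + c) y))|
      ≤ ∫ r in a..b, |φ (flow r x) - φ (flow (r + c) y)| :=
        intervalIntegral.abs_integral_le_integral_abs hab
    _ ≤ ∫ r in a..b, |C| * 4 ^ α * (Real.exp (-α * (r - a)) + Real.exp (-α * (b - r))) :=
        intervalIntegral.integral_mono_on hab (hc1.abs.intervalIntegrable _ _)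
          (Continuous.intervalIntegrable (by fun_prop) _ _) hbound
    _ ≤ |C| * 4 ^ α * (2 / α) := by
        rw [intervalIntegral.integral_const_mul]
        exact mul_le_mul_of_nonneg_left (integral_exp_add_exp_le hα) (by positivity)

/-- Two geodesics that stay close coincide, up to a small shift of time, between two moments at
which the first one turns with an angle greater than `π`. -/
lemma IsBruhatTitsScale.eq_between_turns {A : ConeAtlas S} {R : ℝ} (hρ : IsBruhatTitsScale S ρ)
    (hR : A.IsRadius R) (hRρ : 2 * R < ρ) {x y : GS S} {a b η ε : ℝ} (hη : 0 < η)
    (hab : 1 < b - a) (ha : TurnsBy A R η x a) (hb : TurnsBy A R η x b)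
    (hε : ε ≤ passScale R η) (hε' : ε < ρ / 12) (hε'' : ε ≤ 1 / 4)
    (hxy : ∀ r ∈ Icc (a - R) (b + R), dist (x.1 r) (y.1 r) ≤ ε) :
    ∃ c, |c| ≤ ε ∧ ∀ s ∈ Icc a b, x.1 s = y.1 (s + c) := by
  have hR0 := hR.1
  obtain ⟨τ, hτ, e1, -⟩ := ha.exists_pass (y := y) hρ hR hRρ hη hε
    (hxy _ ⟨by linarith, by linarith⟩) (hxy _ ⟨by linarith, by linarith⟩)
  obtain ⟨σ, hσ, e2, -⟩ := hb.exists_pass (y := y) hρ hR hRρ hη hε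
    (hxy _ ⟨by linarith, by linarith⟩) (hxy _ ⟨by linarith, by linarith⟩)
  obtain ⟨t1, t2⟩ := abs_le.1 hτ
  obtain ⟨s1, s2⟩ := abs_le.1 hσ
  have hba : 0 < b - a := by linarith
  -- Affine map of `[a, b]` onto `[τ, σ]`; `l > 0` because `b - a > 1` and `ε ≤ 1 / 4`. It displaces
  -- times by at most `ε`, so `2ε < ρ / 6` gives the closeness required.
  set l := (σ - τ) / (b - a) with hl
  have hl0 : 0 < l := div_pos (by linarith) hba
  have hlb : l * (b - a) = σ - τ := div_mul_cancel₀ _ hba.ne'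
  refine ⟨τ - a, hτ, hρ.eq_of_same_ends (by linarith) x y hl0 (by linarith) e1.symm ?_ ?_⟩
  · rw [hlb, add_sub_cancel, e2]
  · intro s hs
    have hs0 : 0 ≤ s - a := by linarith [hs.1]
    have hs1 : 0 ≤ b - s := by linarith [hs.2]
    have e3 : |s - (τ + l * (s - a))| ≤ ε := by
      have e4 : (s - (τ + l * (s - a))) * (b - a) =
          -((b - s) * (τ - a) + (s - a) * (σ - b)) := by
        linear_combination (-(s - a)) * hlb
      have e5 : |s - (τ + l * (s - a))| * (b - a) ≤ ε * (b - a) := by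
        rw [← abs_of_pos hba, ← abs_mul, abs_of_pos hba, e4, abs_neg]
        refine (abs_add_le _ _).trans ?_
        rw [abs_mul, abs_mul, abs_of_nonneg hs0, abs_of_nonneg hs1]
        nlinarith [mul_le_mul_of_nonneg_left hτ hs1, mul_le_mul_of_nonneg_left hσ hs0]
      exact le_of_mul_le_mul_right e5 hba
    have e6 := hxy s ⟨by linarith, by linarith⟩
    have e7 := y.dist_le s (τ + l * (s - a))
    linarith [dist_triangle (x.1 s) (y.1 s) (y.1 (τ + l * (s - a)))]

theorem hasGlobalBowenProperty_of_isHolder (hφ : IsHolder x₀ φ) {δ : ℝ} (hδ : 0 < δ)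
    (hloc : IsLocallyConstantOn x₀ φ (nbhdSing x₀ δ)) : HasGlobalBowenProperty x₀ φ := by
  obtain ⟨A⟩ := nonempty_coneAtlas S
  obtain ⟨ρ, hρ0, hball⟩ := A.exists_ball_subset
  have hρ := A.isBruhatTitsScale hball
  have hs := A.isSimplyConnectedScale hball
  obtain ⟨R, hR, hRρ⟩ := A.exists_isRadius hρ0
  have hR0 := hR.1
  have hcont := fun x => hφ.continuous_flow hs hρ0 x
  refine ⟨fun x t => (hcont x).intervalIntegrable _ _, ?_⟩
  obtain ⟨V, hV0, hV⟩ := hφ.exists_abs_sub_le hs hρ0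
  obtain ⟨K, hK0, hK⟩ := hφ.exists_abs_integral_le hs hρ0
  obtain ⟨T, hT, η, hη, ε₁, hε₁, hM⟩ := exists_eq_of_not_turnsBy hρ hs hρ0 hR hRρ hδ hloc
  have hp := passScale_pos hR0 hη
  obtain ⟨ε, hε, hε₁', hεp, hερ, hε4⟩ : ∃ ε > 0, ε ≤ ε₁ ∧ ε ≤ passScale R η ∧ ε < ρ / 12 ∧
      ε ≤ 1 / 4 := by
    refine ⟨min (min ε₁ (passScale R η)) (min (ρ / 13) (1 / 4)), by positivity, ?_, ?_, ?_, ?_⟩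
    · exact (min_le_left _ _).trans (min_le_left _ _)
    · exact (min_le_left _ _).trans (min_le_right _ _)
    · exact ((min_le_right _ _).trans (min_le_left _ _)).trans_lt (by linarith)
    · exact (min_le_right _ _).trans (min_le_right _ _)
  obtain ⟨ε', hε', hclose⟩ := exists_dist_le_of_distGS_le hs hρ0 x₀ hε
  -- `R` is the length needed around a turn, `T` the turn-free window, and `1` the error in locating
  -- the first and last turns.
  set m := R + T + 1 with hm
  refine ⟨ε', hε', 4 * m * V + (K + V) + 1, by positivity, fun x y t ht hxy => ?_⟩
  have hm0 : 0 ≤ m := by positivity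
  have hd : ∀ r ∈ Icc 0 t, dist (x.1 r) (y.1 r) ≤ ε := fun r hr => by
    have h : dist (x.1 (0 + r)) (y.1 (0 + r)) ≤ ε := hclose _ _ (hxy r hr)
    rwa [zero_add] at h
  set f : ℝ → ℝ := fun r => φ (flow r x) - φ (flow r y) with hf
  have hfc : Continuous f := (hcont x).sub (hcont y)
  have hfV : ∀ r, |f r| ≤ V := fun r => hV _ _
  have hzero : ∀ r, R + T ≤ r → r ≤ t - R - T →
      (∀ s, r - T ≤ s → s ≤ r + T → ¬TurnsBy A R η x s) → f r = 0 := by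
    intro r h1 h2 h3
    refine sub_eq_zero.2 (hM _ _ (fun s hs hturn => ?_) fun s hs => ?_)
    · have := abs_le.1 hs
      exact h3 (s + r) (by linarith) (by linarith) hturn.of_flow
    · have := abs_le.1 hs
      exact (hd (s + r) ⟨by linarith, by linarith⟩).trans hε₁'
  set Θ : Set ℝ := {r | r ∈ Icc R (t - R) ∧ TurnsBy A R η x r} with hΘ
  change |∫ r in (0 : ℝ)..t, f r| ≤ _
  rcases Θ.eq_empty_or_nonempty with hempty | hne
  · have := abs_integral_le_of_eq_zero hfc hfV hm0 ht.le fun r h1 h2 =>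
      hzero r (by linarith) (by linarith) fun s h3 h4 h5 => by
        have : s ∈ Θ := ⟨⟨by linarith, by linarith⟩, h5⟩
        rw [hempty] at this
        exact this
    nlinarith
  have hbelow : BddBelow Θ := ⟨R, fun r hr => hr.1.1⟩
  have habove : BddAbove Θ := ⟨t - R, fun r hr => hr.1.2⟩
  -- `Θ` need not be known to contain its bounds, so turns within `1` of them are used.
  obtain ⟨a, b, ha, hb, hab, hainf, hbsup⟩ : ∃ a b, a ∈ Θ ∧ b ∈ Θ ∧ a ≤ b ∧
      a < sInf Θ + 1 ∧ sSup Θ - 1 < b := by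
    obtain ⟨a, ha, ha'⟩ := exists_lt_of_csInf_lt hne (lt_add_one (sInf Θ))
    obtain ⟨b, hb, hb'⟩ := exists_lt_of_lt_csSup hne (sub_one_lt (sSup Θ))
    rcases le_total a b with h | h
    · exact ⟨a, b, ha, hb, h, ha', hb'⟩
    · exact ⟨b, a, hb, ha, h, h.trans_lt ha', hb'.trans_le h⟩
  have hint : ∀ u v, IntervalIntegrable f volume u v := fun u v => hfc.intervalIntegrable u v
  have hfirst : |∫ r in (0 : ℝ)..a, f r| ≤ 2 * m * V := by
    refine abs_integral_le_of_eq_zero hfc hfV hm0 (by linarith [ha.1.1]) fun r h1 h2 =>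
      hzero r (by linarith) (by linarith [ha.1.2]) fun s h3 h4 h5 => ?_
    have := csInf_le hbelow (show s ∈ Θ from ⟨⟨by linarith, by linarith [ha.1.2]⟩, h5⟩)
    linarith
  have hlast : |∫ r in b..t, f r| ≤ 2 * m * V := by
    refine abs_integral_le_of_eq_zero hfc hfV hm0 (by linarith [hb.1.2]) fun r h1 h2 =>
      hzero r (by linarith [hb.1.1]) (by linarith) fun s h3 h4 h5 => ?_
    have := le_csSup habove (show s ∈ Θ from ⟨⟨by linarith [hb.1.1], by linarith⟩, h5⟩)
    linarith
  have hmiddle : |∫ r in a..b, f r| ≤ K + V := by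
    -- Turns at most `1` apart cost at most `V`; otherwise the coincidence costs `K` and the time
    -- shift at most `V`.
    rcases le_or_gt (b - a) 1 with h | h
    · have := intervalIntegral.norm_integral_le_of_norm_le_const (a := a) (b := b) (f := f) (C := V)
        fun r _ => hfV r
      rw [Real.norm_eq_abs, abs_of_nonneg (sub_nonneg.2 hab)] at this
      nlinarith
    · obtain ⟨c, hc, hxc⟩ := hρ.eq_between_turns hR hRρ hη h ha.2 hb.2 hεp hερ hε4
        fun r hr => hd r ⟨by linarith [hr.1, ha.1.1], by linarith [hr.2, hb.1.2]⟩
      have hcy : Continuous fun r => φ (flow (r + c) y) :=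
        (hcont y).comp (continuous_add_const c)
      have e : ∫ r in a..b, f r = (∫ r in a..b, (φ (flow r x) - φ (flow (r + c) y)))
          + ∫ r in a..b, (φ (flow (r + c) y) - φ (flow r y)) := by
        have k1 : Continuous fun r => φ (flow r x) - φ (flow (r + c) y) := (hcont x).sub hcy
        have k2 : Continuous fun r => φ (flow (r + c) y) - φ (flow r y) := hcy.sub (hcont y)
        rw [← intervalIntegral.integral_add (k1.intervalIntegrable _ _)
          (k2.intervalIntegrable _ _)]
        refine intervalIntegral.integral_congr fun r _ => ?_
        simp [hf]
      rw [e]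
      have h1 := hK x y a b c hab hxc
      have h2 := abs_integral_shift_sub_le (hcont y) (fun r s => hV _ _) a b c
      refine (abs_add_le _ _).trans (add_le_add h1 (h2.trans ?_))
      nlinarith [abs_nonneg c]
  have e : ∫ r in (0 : ℝ)..t, f r = (∫ r in (0 : ℝ)..a, f r) + (∫ r in a..b, f r)
      + ∫ r in b..t, f r := by
    rw [intervalIntegral.integral_add_adjacent_intervals (hint _ _) (hint _ _),
      intervalIntegral.integral_add_adjacent_intervals (hint _ _) (hint _ _)]
  rw [e]
  have h1 := abs_add_le ((∫ r in (0 : ℝ)..a, f r) + (∫ r in a..b, f r)) (∫ r in b..t, f r)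
  have h2 := abs_add_le (∫ r in (0 : ℝ)..a, f r) (∫ r in a..b, f r)
  linarith

end Bowen

end FlatSurface

end

theorem theoremC {S : Type*} [MetricSpace S] [FlatSurface.IsFlatConeSurface S] (x₀ : S)
    (φ : FlatSurface.GS S → ℝ) (hφ : FlatSurface.IsHolder x₀ φ)
    (hloc : ∃ δ > 0, FlatSurface.IsLocallyConstantOn x₀ φ (FlatSurface.nbhdSing x₀ δ)) :
    FlatSurface.HasGlobalBowenProperty x₀ φ := by
  obtain ⟨δ, hδ, h⟩ := hloc
  exact FlatSurface.hasGlobalBowenProperty_of_isHolder hφ hδ h
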